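/- Let $d\ge 0$ and let $\mathbb{P}^d=\mathbb{P}(\mathbb{R}^{d+1})$ be the real projective space. A subset of $\mathbb{P}^d$ is properly convex if it is contained, convex and bounded in some affine chart (the complement of a projective hyperplane). Let $X$ be the set of non-empty properly convex open subsets $\Omega$ of $\mathbb{P}^d$, endowed with the Hausdorff topology, i.e. the topology given by the Hausdorff distance between the closures $\overline{\Omega}$ in $\mathbb{P}^d$ (for a distance on $\mathbb{P}^d$ inducing its usual topology). The set $\Omega\in X$ is strictly convex if its boundary $\partial\Omega$ contains no non-trivial segment. The Hilbert distance of $\Omega$ is given by $d_\Omega(x,x)=0$ and, for $x\neq y$ in $\Omega$, $$d_\Omega(x,y)=\frac12\ln\frac{|py|\cdot|qx|}{|px|\cdot|qy|},$$ where $p,q$ are the points at which the line $(xy)$ meets $\partial\Omega$, in the order $p,x,y,q$, and $|\cdot|$ is a Euclidean norm on an affine chart containing $\overline\Omega$. For $\delta>0$, let $X_\delta$ be the set of all $\Omega\in X$ such that $(\Omega,d_\Omega)$ is $\delta$-Gromov-hyperbolic: for all $x,y,z\in\Omega$ and all geodesics $[x,y]$, $[y,z]$, $[z,x]$ of $(\Omega,d_\Omega)$,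 every point of $[x,y]$ is at distance at most $\delta$ from some point of $[y,z]\cup[z,x]$. 1. For every $\delta>0$, the set $X_\delta$ is closed in $X$. 2. Conversely, for every closed subset $F$ of $X$ which is invariant under $\mathrm{PGL}_{d+1}(\mathbb{R})$ and contains only strictly convex sets, there exists a constant $\delta>0$ such that $F\subset X_\delta$. -/

import Mathlib

open Set Topology TopologicalSpace
open scoped LinearAlgebra.Projectivization

noncomputable section

namespace HilbertGeometry

/-- The vector space `ℝ^{d+1}`. -/
abbrev Vec (d : ℕ) : Type := Fin (d + 1) → ℝ

/-- The real projective space `ℙ^d` of lines of `ℝ^{d+1}`. -/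
abbrev ProjSpace (d : ℕ) : Type := ℙ ℝ (Vec d)

/-- The group `PGL_{d+1}(ℝ)`. -/
abbrev ProjGroup (d : ℕ) : Type := Matrix.ProjGenLinGroup (Fin (d + 1)) ℝ

variable {d : ℕ}

/-! ### Topology and metric of the projective space -/

/-- The quotient topology of `ℝ^{d+1} ∖ {0} → ℙ^d`. -/
abbrev quotientTopology (d : ℕ) : TopologicalSpace (ProjSpace d) :=
  TopologicalSpace.coinduced (Projectivization.mk' ℝ : {v : Vec d // v ≠ 0} → ProjSpace d)
    inferInstance

/-- The matrix of the orthogonal projection onto the line spanned by `v`. -/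
def projMatrix (v : Vec d) : Fin (d + 1) → Fin (d + 1) → ℝ :=
  fun i j => v i * v j / (v ⬝ᵥ v)

/-- The matrix of the orthogonal projection onto a line. -/
def lineMatrix (x : ProjSpace d) : Fin (d + 1) → Fin (d + 1) → ℝ :=
  projMatrix x.rep

theorem projMatrix_smul (a : ℝˣ) (v : Vec d) : projMatrix (a • v) = projMatrix v := by
  have ha : (a : ℝ) ≠ 0 := a.ne_zero
  funext i j
  simp only [projMatrix, Pi.smul_apply, Units.smul_def, smul_eq_mul, dotProduct_smul,
    smul_dotProduct]
  rw [show (a : ℝ) * v i * (a * v j) = (a * a) * (v i * v j) by ring,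
    show (a : ℝ) * (a * v ⬝ᵥ v) = (a * a) * (v ⬝ᵥ v) by ring,
    mul_div_mul_left _ _ (mul_ne_zero ha ha)]

theorem lineMatrix_mk (v : Vec d) (hv : v ≠ 0) :
    lineMatrix (Projectivization.mk ℝ v hv) = projMatrix v := by
  obtain ⟨a, ha⟩ := Projectivization.exists_smul_eq_mk_rep ℝ v hv
  rw [lineMatrix, ← ha, projMatrix_smul]

theorem lineMatrix_injective : Function.Injective (lineMatrix (d := d)) := by
  intro x y hxy
  induction x using Projectivization.ind with | _ v hv =>
  induction y using Projectivization.ind with | _ w hw =>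
  rw [lineMatrix_mk, lineMatrix_mk] at hxy
  obtain ⟨j, hj⟩ : ∃ j, v j ≠ 0 := by
    by_contra! h
    exact hv (funext h)
  have hvv : v ⬝ᵥ v ≠ 0 := fun h => hv (dotProduct_self_eq_zero.1 h)
  have hww : w ⬝ᵥ w ≠ 0 := fun h => hw (dotProduct_self_eq_zero.1 h)
  rw [Projectivization.mk_eq_mk_iff']
  refine ⟨w j * (v ⬝ᵥ v) / (v j * (w ⬝ᵥ w)), ?_⟩
  funext i
  have h := congrFun (congrFun hxy i) j
  simp only [projMatrix] at h
  rw [div_eq_div_iff hvv hww] at h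
  simp only [Pi.smul_apply, smul_eq_mul]
  rw [div_mul_eq_mul_div, div_eq_iff (mul_ne_zero hj hww)]
  linarith

theorem continuous_lineMatrix : Continuous[quotientTopology d, inferInstance] lineMatrix := by
  refine continuous_coinduced_dom.2 ?_
  have h : (lineMatrix ∘ (Projectivization.mk' ℝ : {v : Vec d // v ≠ 0} → ProjSpace d)) =
      fun v => projMatrix v.1 := funext fun v => lineMatrix_mk v.1 v.2
  rw [h]
  refine continuous_pi fun i => continuous_pi fun j => ?_
  have hcoord : ∀ k, Continuous fun v : {v : Vec d // v ≠ 0} => v.1 k := fun k =>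
    (continuous_apply k).comp continuous_subtype_val
  refine ((hcoord i).mul (hcoord j)).div ?_ fun v h => v.2 (dotProduct_self_eq_zero.1 h)
  exact continuous_finsetSum _ fun k _ => (hcoord k).mul (hcoord k)

theorem compactSpace_quotient : @CompactSpace (ProjSpace d) (quotientTopology d) := by
  let _ := quotientTopology d
  have hc : Continuous (Projectivization.mk' ℝ : {v : Vec d // v ≠ 0} → ProjSpace d) :=
    continuous_coinduced_rng
  let s : Metric.sphere (0 : Vec d) 1 → {v : Vec d // v ≠ 0} :=
    fun v => ⟨v.1, ne_zero_of_mem_unit_sphere v⟩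
  have hs : Continuous s := by fun_prop
  have hr : range (Projectivization.mk' ℝ ∘ s) = (univ : Set (ProjSpace d)) := by
    refine eq_univ_of_forall fun x => ?_
    induction x using Projectivization.ind with | _ v hv =>
    refine ⟨⟨‖v‖⁻¹ • v, by simp [norm_smul, hv]⟩, ?_⟩
    simp only [Function.comp_apply, s, Projectivization.mk'_eq_mk]
    rw [Projectivization.mk_eq_mk_iff']
    exact ⟨‖v‖⁻¹, rfl⟩
  exact ⟨hr ▸ isCompact_range (hc.comp hs)⟩

theorem quotientTopology_eq :
    quotientTopology d = TopologicalSpace.induced lineMatrix inferInstance := by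
  let _ := quotientTopology d
  have : CompactSpace (ProjSpace d) := compactSpace_quotient
  exact (continuous_lineMatrix.isClosedEmbedding lineMatrix_injective).eq_induced

/-- `ℙ^d` with its usual (quotient) topology, metrised by the distance between the orthogonal
projections onto two lines. -/
instance : MetricSpace (ProjSpace d) :=
  @MetricSpace.replaceTopology _ (quotientTopology d)
    (MetricSpace.induced lineMatrix lineMatrix_injective inferInstance) quotientTopology_eq

instance : CompactSpace (ProjSpace d) := compactSpace_quotient

/-! ### Affine charts and properly convex open sets -/

/-- The affine chart of `ℙ^d` which is the complement of the projective hyperplane `φ = 0`. -/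
def affineChart (φ : Module.Dual ℝ (Vec d)) : Set (ProjSpace d) :=
  {x | φ x.rep ≠ 0}

/-- The identification of the affine chart of `φ` with the affine hyperplane `{v | φ v = 1}`:
a line is sent to the vector at which it meets this hyperplane. -/
def affineCoord (φ : Module.Dual ℝ (Vec d)) (x : ProjSpace d) : Vec d :=
  (φ x.rep)⁻¹ • x.rep

/-- A subset of `ℙ^d` is properly convex if there is an affine chart which contains it and in
which it is convex and bounded. -/
def IsProperlyConvex (S : Set (ProjSpace d)) : Prop :=
  ∃ φ : Module.Dual ℝ (Vec d), φ ≠ 0 ∧ S ⊆ affineChart φ ∧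
    Convex ℝ (affineCoord φ '' S) ∧ Bornology.IsBounded (affineCoord φ '' S)

variable (d) in
/-- The set `X` of (non-empty) properly convex open subsets of `ℙ^d`. -/
@[ext]
structure ConvexBody where
  carrier : Set (ProjSpace d)
  isOpen : IsOpen carrier
  nonempty : carrier.Nonempty
  properlyConvex : IsProperlyConvex carrier

namespace ConvexBody

/-- The closure of a convex body, as a non-empty compact subset of `ℙ^d`. -/
def closure (Ω : ConvexBody d) : NonemptyCompacts (ProjSpace d) :=
  ⟨⟨_root_.closure Ω.carrier, isClosed_closure.isCompact⟩, Ω.nonempty.closure⟩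

/-- The Hausdorff topology on `X`, given by the Hausdorff distance of the closures (Mathlib's
distance on `NonemptyCompacts`). -/
instance : TopologicalSpace (ConvexBody d) :=
  TopologicalSpace.induced closure inferInstance

/-- A convex body is strictly convex if its boundary contains no non-trivial segment. -/
def IsStrictlyConvex (Ω : ConvexBody d) : Prop :=
  ¬ ∃ u v : Vec d, LinearIndependent ℝ ![u, v] ∧
    ∀ w ∈ segment ℝ u v, ∃ hw : w ≠ 0, Projectivization.mk ℝ w hw ∈ frontier Ω.carrier

end ConvexBody

/-! ### The action of the projective group -/

theorem affineCoord_mk (φ : Module.Dual ℝ (Vec d)) (v : Vec d) (hv : v ≠ 0) :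
    affineCoord φ (Projectivization.mk ℝ v hv) = (φ v)⁻¹ • v := by
  obtain ⟨a, ha⟩ := Projectivization.exists_smul_eq_mk_rep ℝ v hv
  have ha0 : (a : ℝ) ≠ 0 := a.ne_zero
  rw [affineCoord, ← ha, Units.smul_def, map_smul, smul_smul, smul_eq_mul, mul_inv_rev, mul_assoc,
    inv_mul_cancel₀ ha0, mul_one]

theorem mk_mem_affineChart (φ : Module.Dual ℝ (Vec d)) (v : Vec d) (hv : v ≠ 0) :
    Projectivization.mk ℝ v hv ∈ affineChart φ ↔ φ v ≠ 0 := by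
  obtain ⟨a, ha⟩ := Projectivization.exists_smul_eq_mk_rep ℝ v hv
  rw [affineChart, mem_ofPred_eq, ← ha, Units.smul_def, map_smul]
  simp

theorem continuous_pgl_smul (g : ProjGroup d) :
    Continuous fun x : ProjSpace d => g • x := by
  induction g using Matrix.ProjGenLinGroup.induction_on with | mk A =>
  refine continuous_coinduced_dom.2 ?_
  have hA : Continuous fun v : Vec d => A • v :=
    LinearMap.continuous_of_finiteDimensional (DistribSMul.toLinearMap ℝ (Vec d) A)
  have h1 : Continuous fun v : {v : Vec d // v ≠ 0} =>
      (⟨A • v.1, (smul_ne_zero_iff_ne A).2 v.2⟩ : {v : Vec d // v ≠ 0}) :=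
    (hA.comp continuous_subtype_val).subtype_mk _
  exact continuous_coinduced_rng.comp h1

theorem isProperlyConvex_pgl_smul (g : ProjGroup d) {S : Set (ProjSpace d)}
    (hS : IsProperlyConvex S) : IsProperlyConvex ((fun x => g • x) '' S) := by
  induction g using Matrix.ProjGenLinGroup.induction_on with | mk A =>
  obtain ⟨φ, hφ, hsub, hconv, hbdd⟩ := hS
  let L : Vec d →ₗ[ℝ] Vec d := DistribSMul.toLinearMap ℝ (Vec d) A
  let M : Vec d →ₗ[ℝ] Vec d := DistribSMul.toLinearMap ℝ (Vec d) A⁻¹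
  have hML : ∀ v, M (L v) = v := fun v => inv_smul_smul A v
  have himg : affineCoord (φ ∘ₗ M) '' ((fun x => Matrix.ProjGenLinGroup.mk A • x) '' S) =
      L '' (affineCoord φ '' S) := by
    rw [image_image, image_image]
    refine image_congr fun x _ => ?_
    induction x using Projectivization.ind with | _ v hv =>
    rw [Projectivization.PGL.mk_smul_mk, affineCoord_mk, affineCoord_mk]
    change (φ (M (L v)))⁻¹ • L v = _
    rw [hML, map_smul]
  refine ⟨φ ∘ₗ M, fun h => hφ ?_, ?_, ?_, ?_⟩
  · refine LinearMap.ext fun v => ?_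
    have := LinearMap.congr_fun h (L v)
    simpa [hML] using this
  · rintro _ ⟨x, hx, rfl⟩
    have hx' := hsub hx
    induction x using Projectivization.ind with | _ v hv =>
    simp only [Projectivization.PGL.mk_smul_mk]
    rw [mk_mem_affineChart] at hx' ⊢
    change φ (M (L v)) ≠ 0
    rwa [hML]
  · rw [himg]
    exact hconv.linear_image L
  · rw [himg]
    exact hbdd.image (LinearMap.toContinuousLinearMap L)

/-- The action of `PGL_{d+1}(ℝ)` on `X`, by taking images of sets. -/
instance : SMul (ProjGroup d) (ConvexBody d) where
  smul g Ω :=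
    { carrier := (fun x => g • x) '' Ω.carrier
      isOpen := by
        have h : (fun x : ProjSpace d => g • x) '' Ω.carrier =
            (fun x => g⁻¹ • x) ⁻¹' Ω.carrier := by
          ext x
          exact mem_smul_set_iff_inv_smul_mem (A := Ω.carrier)
        rw [h]
        exact Ω.isOpen.preimage (continuous_pgl_smul g⁻¹)
      nonempty := Ω.nonempty.image _
      properlyConvex := isProperlyConvex_pgl_smul g Ω.properlyConvex }

/-! ### The Hilbert distance -/

/-- The Hilbert distance of `Ω` computed in the affine chart of `φ`. For `x ≠ y` in `Ω`, the line
through `x` and `y` is cut by `Ω` in an open segment with end points `p` and `q`, in the order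
`p, x, y, q`. (The quotients `|py| / |px|` and `|qx| / |qy|` of lengths along one line do not
depend on the norm.) -/
def hilbertDistIn (φ : Module.Dual ℝ (Vec d)) (Ω : Set (ProjSpace d)) (x y : ProjSpace d) : ℝ :=
  open scoped Classical in
  if x = y then 0 else
    let x' := affineCoord φ x
    let y' := affineCoord φ y
    let I : Set ℝ := {t | AffineMap.lineMap x' y' t ∈ affineCoord φ '' Ω}
    let p : Vec d := AffineMap.lineMap x' y' (sInf I)
    let q : Vec d := AffineMap.lineMap x' y' (sSup I)
    (1 / 2) * Real.log ((dist p y' * dist q x') / (dist p x' * dist q y'))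

namespace ConvexBody

/-- An affine chart in which the convex body is bounded, that is, one which contains its
closure. -/
def chart (Ω : ConvexBody d) : Module.Dual ℝ (Vec d) := Ω.properlyConvex.choose

/-- The Hilbert distance of a convex body. As a logarithm of a cross-ratio, it does not depend on
the affine chart containing the closure that is used to compute it. -/
def hilbertDist (Ω : ConvexBody d) (x y : Ω.carrier) : ℝ :=
  hilbertDistIn Ω.chart Ω.carrier x y

end ConvexBody

/-! ### Gromov-hyperbolicity -/

/-- `A` is (the image of) a geodesic from `x` to `y` for the distance function `D`. -/
def IsGeodesic {α : Type*} (D : α → α → ℝ) (x y : α) (A : Set α) : Prop :=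
  ∃ γ : ℝ → α, γ 0 = x ∧ γ (D x y) = y ∧
    (∀ s ∈ Icc 0 (D x y), ∀ t ∈ Icc 0 (D x y), D (γ s) (γ t) = |s - t|) ∧
    A = γ '' Icc 0 (D x y)

/-- Every geodesic triangle is `δ`-thin: each side is contained in the `δ`-neighbourhood of the
union of the two other sides. -/
def IsGromovHyperbolic {α : Type*} (D : α → α → ℝ) (δ : ℝ) : Prop :=
  ∀ (x y z : α) (A B C : Set α), IsGeodesic D x y A → IsGeodesic D y z B → IsGeodesic D z x C →
    ∀ u ∈ A, ∃ v ∈ B ∪ C, D u v ≤ δ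

/-- The set `X_δ` of the properly convex open sets which are `δ`-Gromov-hyperbolic for the Hilbert
distance. -/
def hyperbolicBodies (d : ℕ) (δ : ℝ) : Set (ConvexBody d) :=
  {Ω | IsGromovHyperbolic Ω.hilbertDist δ}

end HilbertGeometry

end

open Filter

noncomputable section

namespace HilbertGeometry

/-! ### Open convex cones -/

section Cone

variable {E : Type*} [NormedAddCommGroup E] [NormedSpace ℝ E]

/-! Everything takes place in the open convex cone over Ω. Let M(x/y) be the least l such that l y -
x lies in the closed cone (`coneGauge`); the Hilbert distance is ½ log (M(x/y) M(y/x)) by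
`hilbertDist_eq`. The relation `ConeClose` expresses "distance at most δ" by two memberships in the
closed cone and one inequality: it ignores the choice of representatives, makes sense up to the
boundary, and survives limits. `IsThin` states thinness of straight triangles in these terms.

Straight segments are always geodesics, so hyperbolic bodies are thin. For a strictly convex body,
equality in M(x/z) ≤ M(x/y) M(y/z) forces y onto the segment from x to z; there are then no other
geodesics, and thinness gives back hyperbolicity with the same δ (`hyperbolic_of_isThin`).

Closedness: thinness passes to limits by compactness of the sides (`IsConeLimit.isThin`), and it
forces strict convexity (`IsSharpCone.isStrictCone`). Indeed, if the boundary had a maximal segment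
[a, b], let x → a and y → b with z fixed inside: the point near x + y on one of the other two sides
would have to tend to a or b, although a + b is infinitely far from both. Hence a limit of bodies of
X_δ is thin and strictly convex, so it belongs to X_δ.

Uniformity: otherwise there are bodies in F and triangles in which some point x + y is farther than
n + 1 from the other two sides. Benzécri's normalisation (`IsSharpCone.exists_normalization`) moves
this point to (1, …, 1) and traps the cone between a fixed neighbourhood of it and the orthant, so
that a nondegenerate limit Ω₀ exists, and Ω₀ ∈ F. The other two sides escape to infinity, so they
tend to segments in the boundary of Ω₀; strict convexity collapses both to the limit z₀ of the third
vertex. Then (1, …, 1) = x₀ + y₀ is a multiple of the boundary vector z₀, which is absurd. -/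

/-- An open convex cone (without its apex, or the whole space). -/
structure IsOpenCone (C : Set E) : Prop where
  isOpen : IsOpen C
  convex : Convex ℝ C
  smul_mem : ∀ v ∈ C, ∀ t : ℝ, 0 < t → t • v ∈ C

/-- A non-empty open convex cone on which `φ` is bounded below by a positive multiple of the
norm. -/
structure IsSharpCone (φ : E →ₗ[ℝ] ℝ) (C : Set E) : Prop extends IsOpenCone C where
  nonempty : C.Nonempty
  zero_notMem : (0 : E) ∉ C
  bound : ∃ c > 0, ∀ v ∈ C, c * ‖v‖ ≤ φ v

namespace IsOpenCone

variable {C : Set E} (hC : IsOpenCone C) {u v w : E}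

include hC

theorem add_mem (hu : u ∈ C) (hv : v ∈ C) : u + v ∈ C := by
  have h := hC.convex hu hv (a := 1 / 2) (b := 1 / 2) (by norm_num) (by norm_num) (by norm_num)
  have h2 := hC.smul_mem _ h 2 (by norm_num)
  convert h2 using 1
  module

theorem smul_mem_closure (hv : v ∈ closure C) {t : ℝ} (ht : 0 < t) : t • v ∈ closure C :=
  map_mem_closure (continuous_const_smul t) hv fun _ hx => hC.smul_mem _ hx t ht

theorem smul_mem_closure' (hv : v ∈ closure C) {t : ℝ} (ht : 0 ≤ t) : t • v ∈ closure C := by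
  have h : Tendsto (fun s : ℝ => s • v) (𝓝[>] t) (𝓝 (t • v)) :=
    ((continuous_id.smul continuous_const).tendsto t).mono_left nhdsWithin_le_nhds
  refine isClosed_closure.mem_of_tendsto h ?_
  filter_upwards [self_mem_nhdsWithin] with s hs
  exact hC.smul_mem_closure hv (ht.trans_lt hs)

theorem add_mem_closure (hu : u ∈ closure C) (hv : v ∈ closure C) : u + v ∈ closure C :=
  map_mem_closure₂ continuous_add hu hv fun _ ha _ hb => hC.add_mem ha hb

/-- Replace v by a nearby w ∈ C; the error v - w is absorbed by u, since C is open. This is the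
standard way below to show that a vector is interior. -/
theorem add_mem_of_mem_closure (hu : u ∈ C) (hv : v ∈ closure C) : u + v ∈ C := by
  have h : Tendsto (fun w => u + v - w) (𝓝 v) (𝓝 u) := by
    have : Continuous fun w => u + v - w := by fun_prop
    simpa using this.tendsto v
  obtain ⟨w, hw, hwC⟩ := mem_closure_iff_nhds.1 hv _ (h (hC.isOpen.mem_nhds hu))
  have := hC.add_mem hw hwC
  simpa using this

theorem neg : IsOpenCone (-C) where
  isOpen := hC.isOpen.neg
  convex := hC.convex.neg
  smul_mem v hv t ht := by
    rw [Set.mem_neg, ← smul_neg]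
    exact hC.smul_mem _ hv t ht

/-- After division by t, the vector tends to v, and C is open. Interior points are thus order units,
which makes gauges finite. -/
theorem eventually_smul_sub_mem (hv : v ∈ C) (u : E) : ∀ᶠ t : ℝ in atTop, t • v - u ∈ C := by
  have h : Tendsto (fun t : ℝ => v - t⁻¹ • u) atTop (𝓝 v) := by
    have := (tendsto_inv_atTop_zero (𝕜 := ℝ)).smul_const u
    simpa using tendsto_const_nhds (x := v).sub this
  filter_upwards [h (hC.isOpen.mem_nhds hv), eventually_gt_atTop 0] with t ht h0
  have := hC.smul_mem _ ht t h0
  rwa [smul_sub, smul_inv_smul₀ h0.ne'] at this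

/-- For large t the vector t v - f(w) w is in C, whence t f(v) ≥ f(w)² > 0. -/
theorem pos_of_nonneg {f : E →ₗ[ℝ] ℝ} (hf : ∀ a ∈ C, 0 ≤ f a) (hw : f w ≠ 0) (hv : v ∈ C) :
    0 < f v := by
  obtain ⟨t, ht, h0⟩ :=
    ((hC.eventually_smul_sub_mem hv (f w • w)).and (eventually_gt_atTop 0)).exists
  have := hf _ ht
  simp only [map_sub, map_smul, smul_eq_mul] at this
  have h2 : 0 < f w * f w := mul_self_pos.2 hw
  exact pos_of_mul_pos_right (by linarith) h0.le

/-- A point outside an open convex cone is separated from it by a linear functional. -/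
theorem exists_functional (hne : C.Nonempty) (hv : v ∉ C) :
    ∃ g : E →L[ℝ] ℝ, (∀ a ∈ C, 0 < g a) ∧ g v ≤ 0 := by
  obtain ⟨f, hf⟩ := geometric_hahn_banach_open_point hC.convex hC.isOpen hv
  -- Since f < f v on a cone, scaling a to infinity gives f ≤ 0 on C, and scaling it to 0 gives 0 ≤
  -- f v.
  have h1 : ∀ a ∈ C, f a ≤ 0 := by
    intro a ha
    by_contra! h
    have := hf _ (hC.smul_mem a ha ((|f v| + 1) / f a) (by positivity))
    rw [map_smul, smul_eq_mul, div_mul_cancel₀ _ h.ne'] at this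
    linarith [le_abs_self (f v)]
  have h2 : 0 ≤ f v := by
    obtain ⟨a, ha⟩ := hne
    by_contra! h
    have h3 := h1 a ha
    have := hf _ (hC.smul_mem a ha ((- f v) / (2 * (|f a| + 1))) (by
      apply div_pos <;> [linarith; positivity]))
    rw [map_smul, smul_eq_mul, abs_of_nonpos h3, div_mul_eq_mul_div, div_lt_iff₀ (by linarith)]
      at this
    nlinarith
  obtain ⟨a, ha⟩ := hne
  have h4 := hf a ha
  refine ⟨-f, fun b hb => ?_, by simpa using h2⟩
  have h5 : ∃ w, f w ≠ 0 := by
    by_contra! h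
    simp [h] at h4
  obtain ⟨w, hw⟩ := h5
  exact hC.pos_of_nonneg (f := -(f : E →ₗ[ℝ] ℝ)) (w := w)
    (fun b hb => by simpa using h1 b hb) (by simpa using hw) hb

end IsOpenCone

namespace IsSharpCone

variable [FiniteDimensional ℝ E] {φ : E →ₗ[ℝ] ℝ} {C : Set E} (hC : IsSharpCone φ C) {u v : E}

include hC

theorem bound_closure : ∃ c > 0, ∀ v ∈ closure C, c * ‖v‖ ≤ φ v := by
  obtain ⟨c, hc, h⟩ := hC.bound
  have hφ : Continuous φ := φ.continuous_of_finiteDimensional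
  exact ⟨c, hc, fun v hv => closure_minimal (t := {v | c * ‖v‖ ≤ φ v}) h
    (isClosed_le (by fun_prop) hφ) hv⟩

theorem nonneg (hv : v ∈ closure C) : 0 ≤ φ v := by
  obtain ⟨c, hc, h⟩ := hC.bound_closure
  exact le_trans (by positivity) (h v hv)

theorem pos_of_ne (hv : v ∈ closure C) (h0 : v ≠ 0) : 0 < φ v := by
  obtain ⟨c, hc, h⟩ := hC.bound_closure
  exact lt_of_lt_of_le (by positivity) (h v hv)

theorem pos (hv : v ∈ C) : 0 < φ v :=
  hC.pos_of_ne (subset_closure hv) fun h => hC.zero_notMem (h ▸ hv)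

omit [FiniteDimensional ℝ E] in
theorem zero_mem_closure : (0 : E) ∈ closure C := by
  obtain ⟨v, hv⟩ := hC.nonempty
  simpa using hC.smul_mem_closure' (subset_closure hv) le_rfl

theorem eq_zero (hv : v ∈ closure C) (hv' : -v ∈ closure C) : v = 0 := by
  by_contra h
  have h1 := hC.pos_of_ne hv h
  have h2 := hC.nonneg hv'
  rw [map_neg] at h2
  linarith

end IsSharpCone

/-! ### The gauge of a cone -/

/-- The least `l` such that `l • y - x` belongs to the closure of `C`. -/
def coneGauge (C : Set E) (x y : E) : ℝ := sInf {l : ℝ | l • y - x ∈ closure C}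

/-- The relation "at Hilbert distance at most `δ`" for points of the closure of a cone. -/
def ConeClose (C : Set E) (δ : ℝ) (u v : E) : Prop :=
  ∃ a b : ℝ, 0 < a ∧ 0 < b ∧ a • v - u ∈ closure C ∧ b • u - v ∈ closure C ∧
    a * b ≤ Real.exp (2 * δ)

/-- Thinness of the straight triangles of a cone. Every point of the open segment between two
points of the projectivised cone is the class of the sum of suitable representatives. -/
def IsThin (C : Set E) (δ : ℝ) : Prop :=
  ∀ x ∈ C, ∀ y ∈ C, ∀ z ∈ C, ∃ v ∈ segment ℝ y z ∪ segment ℝ z x, ConeClose C δ (x + y) v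

/-- The boundary of the projectivised cone contains no non-trivial segment. -/
def IsStrictCone (C : Set E) : Prop :=
  ∀ u ∈ closure C, ∀ v ∈ closure C, LinearIndependent ℝ ![u, v] → ∃ w ∈ segment ℝ u v, w ∈ C

/-- An admissible m < l would put l y - x = (l - m) y + (m y - x) in the open cone. Gauges are
computed by exhibiting a boundary vector l y - x. -/
theorem IsOpenCone.coneGauge_eq {C : Set E} (hC : IsOpenCone C) {x y : E} {l : ℝ} (hy : y ∈ C)
    (h : l • y - x ∈ closure C) (h' : l • y - x ∉ C) : coneGauge C x y = l := by
  have : {m : ℝ | m • y - x ∈ closure C} = Ici l := by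
    ext m
    simp only [mem_ofPred_eq, mem_Ici]
    constructor
    · intro hm
      by_contra! hlt
      refine h' ?_
      have := hC.add_mem_of_mem_closure (hC.smul_mem y hy (l - m) (by linarith)) hm
      convert this using 1
      module
    · intro hm
      rcases hm.eq_or_lt with rfl | hlt
      · exact h
      · have := hC.add_mem_of_mem_closure (hC.smul_mem y hy (m - l) (by linarith)) h
        refine subset_closure ?_
        convert this using 1
        module
  rw [coneGauge, this, csInf_Ici]

namespace IsSharpCone

variable [FiniteDimensional ℝ E] {φ : E →ₗ[ℝ] ℝ} {C : Set E} (hC : IsSharpCone φ C) {x y : E}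

include hC

theorem bddBelow_gauge (x : E) (hy : y ∈ C) : BddBelow {l : ℝ | l • y - x ∈ closure C} := by
  refine ⟨φ x / φ y, fun l hl => ?_⟩
  have := hC.nonneg hl
  rw [map_sub, map_smul, smul_eq_mul] at this
  rw [div_le_iff₀ (hC.pos hy)]
  linarith

theorem coneGauge_mem_closure (x : E) (hy : y ∈ C) : coneGauge C x y • y - x ∈ closure C := by
  have hcl : IsClosed {l : ℝ | l • y - x ∈ closure C} :=
    isClosed_closure.preimage (by fun_prop : Continuous fun l : ℝ => l • y - x)
  obtain ⟨l, hl⟩ := (hC.eventually_smul_sub_mem hy x).exists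
  exact hcl.csInf_mem ⟨l, subset_closure hl⟩ (hC.bddBelow_gauge x hy)

theorem coneGauge_le {l : ℝ} (hy : y ∈ C) (h : l • y - x ∈ closure C) : coneGauge C x y ≤ l :=
  csInf_le (hC.bddBelow_gauge x hy) h

theorem coneGauge_notMem (x : E) (hy : y ∈ C) : coneGauge C x y • y - x ∉ C := by
  intro h
  have hc : Tendsto (fun l : ℝ => l • y - x) (𝓝[<] coneGauge C x y)
      (𝓝 (coneGauge C x y • y - x)) :=
    ((by fun_prop : Continuous fun l : ℝ => l • y - x).tendsto _).mono_left nhdsWithin_le_nhds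
  have h1 : ∀ᶠ l in 𝓝[<] coneGauge C x y, l • y - x ∈ C := hc (hC.isOpen.mem_nhds h)
  obtain ⟨l, hl, hlt⟩ := (h1.and (self_mem_nhdsWithin (s := Iio _))).exists
  exact absurd (hC.coneGauge_le hy (subset_closure hl)) (not_le.2 hlt)

theorem coneGauge_pos (hx : x ∈ C) (hy : y ∈ C) : 0 < coneGauge C x y := by
  have := hC.nonneg (hC.coneGauge_mem_closure x hy)
  rw [map_sub, map_smul, smul_eq_mul] at this
  exact pos_of_mul_pos_left (by linarith [hC.pos hx]) (hC.pos hy).le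

/-- The two gauges are the least admissible constants a and b, and they are attained. -/
theorem coneClose_iff (hx : x ∈ C) (hy : y ∈ C) {δ : ℝ} :
    ConeClose C δ x y ↔ 1 / 2 * Real.log (coneGauge C x y * coneGauge C y x) ≤ δ := by
  have h1 := hC.coneGauge_pos hx hy
  have h2 := hC.coneGauge_pos hy hx
  have key : 1 / 2 * Real.log (coneGauge C x y * coneGauge C y x) ≤ δ ↔
      coneGauge C x y * coneGauge C y x ≤ Real.exp (2 * δ) := by
    rw [← Real.log_le_iff_le_exp (by positivity)]
    constructor <;> intro h <;> linarith
  rw [key]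
  constructor
  · rintro ⟨a, b, ha, hb, h3, h4, h5⟩
    refine le_trans ?_ h5
    exact mul_le_mul (hC.coneGauge_le hy h3) (hC.coneGauge_le hx h4) h2.le ha.le
  · intro h
    exact ⟨_, _, h1, h2, hC.coneGauge_mem_closure x hy, hC.coneGauge_mem_closure y hx, h⟩

omit [FiniteDimensional ℝ E] in
theorem coneClose_refl {δ : ℝ} (hδ : 0 ≤ δ) (x : E) : ConeClose C δ x x := by
  refine ⟨1, 1, one_pos, one_pos, ?_, ?_, ?_⟩
  · simpa using hC.zero_mem_closure
  · simpa using hC.zero_mem_closure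
  · simpa using hδ

end IsSharpCone

/-- Rescaling multiplies a and b by inverse factors, so the product a b is a projective quantity. -/
theorem IsOpenCone.coneClose_smul {C : Set E} (hC : IsOpenCone C) {δ : ℝ} {u v : E} {s t : ℝ}
    (hs : 0 < s) (ht : 0 < t) (h : ConeClose C δ u v) : ConeClose C δ (s • u) (t • v) := by
  obtain ⟨a, b, ha, hb, h1, h2, h3⟩ := h
  refine ⟨s * a / t, t * b / s, by positivity, by positivity, ?_, ?_, ?_⟩
  · have := hC.smul_mem_closure h1 hs
    convert this using 1
    rw [smul_smul, div_mul_cancel₀ _ ht.ne', smul_sub, smul_smul]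
  · have := hC.smul_mem_closure h2 ht
    convert this using 1
    rw [smul_smul, div_mul_cancel₀ _ hs.ne', smul_sub, smul_smul]
  · convert h3 using 1
    field_simp

omit [NormedSpace ℝ E] in
theorem neg_mem_closure_neg {C : Set E} {v : E} (h : v ∈ closure C) : -v ∈ closure (-C) :=
  map_mem_closure continuous_neg h fun x hx => by simpa using hx

theorem ConeClose.neg {C : Set E} {δ : ℝ} {u v : E} (h : ConeClose C δ u v) :
    ConeClose (-C) δ (-u) (-v) := by
  obtain ⟨a, b, ha, hb, h1, h2, h3⟩ := h
  refine ⟨a, b, ha, hb, ?_, ?_, h3⟩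
  · convert neg_mem_closure_neg h1 using 1
    module
  · convert neg_mem_closure_neg h2 using 1
    module

/-- Needed because changing the chart may replace the cone over a body by its opposite. -/
theorem IsThin.neg {C : Set E} {δ : ℝ} (h : IsThin C δ) : IsThin (-C) δ := by
  intro x hx y hy z hz
  obtain ⟨v, hv, hv'⟩ := h _ hx _ hy _ hz
  have hseg : ∀ a b : E, v ∈ segment ℝ (-a) (-b) → -v ∈ segment ℝ a b := by
    rintro a b ⟨s, t, hs, ht, hst, rfl⟩
    exact ⟨s, t, hs, ht, hst, by module⟩
  refine ⟨-v, hv.imp (hseg _ _) (hseg _ _), ?_⟩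
  have := hv'.neg
  rwa [neg_add, neg_neg, neg_neg] at this

end Cone

/-! ### Limits of cones along an ultrafilter -/

section Limit

variable {E : Type*} [NormedAddCommGroup E] [NormedSpace ℝ E] {ι : Type*} {𝒰 : Ultrafilter ι}

/-- Working along an ultrafilter replaces the successive extraction of subsequences. -/
theorem exists_tendsto_of_eventually_mem {X : Type*} [TopologicalSpace X] {s : Set X}
    (hs : IsCompact s) {f : ι → X} (h : ∀ᶠ i in 𝒰, f i ∈ s) : ∃ x ∈ s, Tendsto f 𝒰 (𝓝 x) :=
  hs.ultrafilter_le_nhds (𝒰.map f) (le_principal_iff.2 h)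

/-- `K` is the limit of the closures of the sets `C i` in the sense of Kuratowski. -/
structure IsConeLimit (𝒰 : Ultrafilter ι) (C : ι → Set E) (K : Set E) : Prop where
  exists_lim : ∀ v ∈ K, ∃ w : ι → E, (∀ᶠ i in 𝒰, w i ∈ closure (C i)) ∧ Tendsto w 𝒰 (𝓝 v)
  mem_of_lim : ∀ (w : ι → E) (v : E), (∀ᶠ i in 𝒰, w i ∈ closure (C i)) → Tendsto w 𝒰 (𝓝 v) →
    v ∈ K

omit [NormedSpace ℝ E] in
theorem isConeLimit_const (𝒰 : Ultrafilter ι) (C : Set E) :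
    IsConeLimit 𝒰 (fun _ => C) (closure C) where
  exists_lim v hv := ⟨fun _ => v, Eventually.of_forall fun _ => hv, tendsto_const_nhds⟩
  mem_of_lim _ _ hw hv := isClosed_closure.mem_of_tendsto hv hw

variable {C : ι → Set E} {C₀ : Set E}

/-- Points converging to a point of the open limit cone are eventually in the open cones. -/
theorem IsConeLimit.eventually_mem [FiniteDimensional ℝ E]
    (h : IsConeLimit 𝒰 C (closure C₀)) (hC : ∀ᶠ i in 𝒰, IsOpenCone (C i)) (hC₀ : IsOpenCone C₀)
    {w : ι → E} {v : E} (hv : v ∈ C₀) (hw : Tendsto w 𝒰 (𝓝 v)) : ∀ᶠ i in 𝒰, w i ∈ C i := by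
  by_contra hcon
  rw [← Ultrafilter.eventually_not] at hcon
  have hne : ∀ᶠ i in 𝒰, (C i).Nonempty := by
    obtain ⟨a, ha, -⟩ := h.exists_lim v (subset_closure hv)
    filter_upwards [ha] with i hi
    exact closure_nonempty_iff.1 ⟨_, hi⟩
  -- If w i stayed outside C i, unit functionals separating them would converge to a nonzero g,
  -- nonnegative on C₀ with g v ≤ 0, contradicting `pos_of_nonneg`.
  have hex : ∀ᶠ i in 𝒰, ∃ f : E →L[ℝ] ℝ, f ∈ Metric.sphere 0 1 ∧ (∀ a ∈ closure (C i), 0 ≤ f a) ∧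
      f (w i) ≤ 0 := by
    filter_upwards [hC, hne, hcon] with i hi hi' hi''
    obtain ⟨g, hg, hg'⟩ := hi.exists_functional hi' hi''
    have hg0 : g ≠ 0 := by
      rintro rfl
      obtain ⟨a, ha⟩ := hi'
      simpa using hg a ha
    have hn : 0 < ‖g‖ := norm_pos_iff.2 hg0
    refine ⟨‖g‖⁻¹ • g, by simp [norm_smul, hn.ne'], fun a ha => ?_, ?_⟩
    · have : 0 ≤ g a :=
        closure_minimal (t := {a | 0 ≤ g a}) (fun a ha => (hg a ha).le)
          (isClosed_le continuous_const g.continuous) ha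
      simp only [smul_apply, smul_eq_mul]
      positivity
    · simp only [smul_apply, smul_eq_mul]
      exact mul_nonpos_of_nonneg_of_nonpos (by positivity) hg'
  obtain ⟨f, hf⟩ := hex.choice
  have : ProperSpace (E →L[ℝ] ℝ) := FiniteDimensional.proper ℝ _
  obtain ⟨g, hg, hlim⟩ := exists_tendsto_of_eventually_mem (isCompact_sphere (0 : E →L[ℝ] ℝ) 1)
    (hf.mono fun i hi => hi.1)
  have happ : ∀ (b : ι → E) (a : E), Tendsto b 𝒰 (𝓝 a) →
      Tendsto (fun i => f i (b i)) 𝒰 (𝓝 (g a)) := fun b a hb =>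
    (isBoundedBilinearMap_apply.continuous.tendsto (g, a)).comp (hlim.prodMk_nhds hb)
  have hpos : ∀ a ∈ C₀, 0 ≤ (g : E →ₗ[ℝ] ℝ) a := by
    intro a ha
    obtain ⟨b, hb, hb'⟩ := h.exists_lim a (subset_closure ha)
    refine ge_of_tendsto (happ b a hb') ?_
    filter_upwards [hf, hb] with i hi hi'
    exact hi.2.1 _ hi'
  have hle : g v ≤ 0 := le_of_tendsto (happ w v hw) (hf.mono fun i hi => hi.2.2)
  have hgw : ∃ w, g w ≠ 0 := by
    by_contra! h0
    have : g = 0 := ContinuousLinearMap.ext h0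
    simp [this] at hg
  obtain ⟨a, ha⟩ := hgw
  exact absurd (hC₀.pos_of_nonneg hpos (w := a) ha hv) (not_lt.2 hle)

/-- Applying φ to a v - u bounds a from below, likewise b, and the bound on a b then bounds both
from above; so the constants converge. The limits u₀ and v₀ may be on the boundary: only positivity
of φ is used. -/
theorem IsConeLimit.coneClose (h : IsConeLimit 𝒰 C (closure C₀)) [FiniteDimensional ℝ E]
    {φ : E →ₗ[ℝ] ℝ} (hφ : ∀ᶠ i in 𝒰, ∀ v ∈ C i, 0 ≤ φ v) {δ : ℝ} {u v : ι → E} {u₀ v₀ : E}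
    (hu : Tendsto u 𝒰 (𝓝 u₀)) (hv : Tendsto v 𝒰 (𝓝 v₀)) (hu₀ : 0 < φ u₀) (hv₀ : 0 < φ v₀)
    (huv : ∀ᶠ i in 𝒰, ConeClose (C i) δ (u i) (v i)) : ConeClose C₀ δ u₀ v₀ := by
  have hc : Continuous φ := φ.continuous_of_finiteDimensional
  have hφ' : ∀ᶠ i in 𝒰, ∀ v ∈ closure (C i), 0 ≤ φ v := hφ.mono fun i hi a ha =>
    closure_minimal (t := {a | 0 ≤ φ a}) hi (isClosed_le continuous_const hc) ha
  have hφu : Tendsto (fun i => φ (u i)) 𝒰 (𝓝 (φ u₀)) := (hc.tendsto _).comp hu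
  have hφv : Tendsto (fun i => φ (v i)) 𝒰 (𝓝 (φ v₀)) := (hc.tendsto _).comp hv
  set e := Real.exp (2 * δ) with he
  have he0 : 0 < e := Real.exp_pos _
  -- The factor 4 leaves room for φ (u i) > φ u₀ / 2 and φ (v i) < 2 φ v₀.
  set m := φ u₀ / (4 * φ v₀) with hm
  set m' := φ v₀ / (4 * φ u₀) with hm'
  have hm0 : 0 < m := by positivity
  have hm0' : 0 < m' := by positivity
  have hex : ∀ᶠ i in 𝒰, ∃ p : ℝ × ℝ, p ∈ Icc m (e / m') ×ˢ Icc m' (e / m) ∧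
      p.1 • v i - u i ∈ closure (C i) ∧ p.2 • u i - v i ∈ closure (C i) ∧ p.1 * p.2 ≤ e := by
    filter_upwards [huv, hφ', Tendsto.eventually_const_lt (half_lt_self hu₀) hφu,
      Tendsto.eventually_lt_const (lt_two_mul_self hu₀) hφu,
      Tendsto.eventually_const_lt (half_lt_self hv₀) hφv,
      Tendsto.eventually_lt_const (lt_two_mul_self hv₀) hφv]
      with i ⟨a, b, ha, hb, h1, h2, h3⟩ hi hu1 hu2 hv1 hv2
    have h4 := hi _ h1
    have h5 := hi _ h2
    rw [map_sub, map_smul, smul_eq_mul] at h4 h5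
    have ha' : m ≤ a := by
      rw [hm, div_le_iff₀ (by positivity)]
      nlinarith
    have hb' : m' ≤ b := by
      rw [hm', div_le_iff₀ (by positivity)]
      nlinarith
    refine ⟨(a, b), ⟨⟨ha', ?_⟩, ⟨hb', ?_⟩⟩, h1, h2, h3⟩
    · rw [le_div_iff₀ hm0']
      exact (mul_le_mul_of_nonneg_left hb' ha.le).trans h3
    · rw [le_div_iff₀ hm0, mul_comm]
      exact (mul_le_mul_of_nonneg_right ha' hb.le).trans h3
  obtain ⟨p, hp⟩ := hex.choice
  obtain ⟨⟨a, b⟩, ⟨ha, hb⟩, hlim⟩ := exists_tendsto_of_eventually_mem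
    (isCompact_Icc.prod isCompact_Icc) (hp.mono fun i hi => hi.1)
  have hla : Tendsto (fun i => (p i).1) 𝒰 (𝓝 a) := (continuous_fst.tendsto _).comp hlim
  have hlb : Tendsto (fun i => (p i).2) 𝒰 (𝓝 b) := (continuous_snd.tendsto _).comp hlim
  exact ⟨a, b, hm0.trans_le ha.1, hm0'.trans_le hb.1,
    h.mem_of_lim _ _ (hp.mono fun i hi => hi.2.1) ((hla.smul hv).sub hu),
    h.mem_of_lim _ _ (hp.mono fun i hi => hi.2.2.1) ((hlb.smul hu).sub hv),
    le_of_tendsto (hla.mul hlb) (hp.mono fun i hi => hi.2.2.2)⟩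

theorem isCompact_segment' (x y : E) : IsCompact (segment ℝ x y) := by
  rw [segment_eq_image_lineMap]
  exact isCompact_Icc.image AffineMap.lineMap_continuous

/-- Thinness passes to the limit. -/
theorem IsConeLimit.isThin [FiniteDimensional ℝ E] (h : IsConeLimit 𝒰 C (closure C₀))
    (hC : ∀ᶠ i in 𝒰, IsOpenCone (C i)) {φ : E →ₗ[ℝ] ℝ} (hC₀ : IsSharpCone φ C₀)
    (hφ : ∀ᶠ i in 𝒰, ∀ v ∈ C i, 0 ≤ φ v) {δ : ℝ} (ht : ∀ᶠ i in 𝒰, IsThin (C i) δ) :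
    IsThin C₀ δ := by
  intro x hx y hy z hz
  have hev : ∀ w ∈ C₀, ∀ᶠ i in 𝒰, w ∈ C i := fun w hw =>
    h.eventually_mem hC hC₀.toIsOpenCone hw tendsto_const_nhds
  -- The vertices are kept fixed, so all witnesses lie in the same compact set.
  have hex : ∀ᶠ i in 𝒰, ∃ v, v ∈ segment ℝ y z ∪ segment ℝ z x ∧ ConeClose (C i) δ (x + y) v := by
    filter_upwards [ht, hev x hx, hev y hy, hev z hz] with i hi hx hy hz
    exact hi x hx y hy z hz
  obtain ⟨v, hv⟩ := hex.choice
  obtain ⟨v₀, hv₀, hlim⟩ := exists_tendsto_of_eventually_mem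
    ((isCompact_segment' y z).union (isCompact_segment' z x)) (hv.mono fun i hi => hi.1)
  refine ⟨v₀, hv₀, h.coneClose hφ tendsto_const_nhds hlim (hC₀.pos (hC₀.add_mem hx hy))
    (hC₀.pos ?_) (hv.mono fun i hi => hi.2)⟩
  rcases hv₀ with hv₀ | hv₀
  · exact hC₀.convex.segment_subset hy hz hv₀
  · exact hC₀.convex.segment_subset hz hx hv₀

/-! ### Thin triangles force strict convexity -/

/-- The extremal point, in the direction opposite to `v`, of a plane section of a sharp cone. -/
theorem IsSharpCone.exists_extremal [FiniteDimensional ℝ E] {φ : E →ₗ[ℝ] ℝ} {C : Set E}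
    (hC : IsSharpCone φ C) {u v : E} (hu : u ∈ closure C) (hv : v ∈ closure C) (hv0 : v ≠ 0) :
    ∃ t : ℝ, 0 ≤ t ∧ u - t • v ∈ closure C ∧ ∀ s, t < s → u - s • v ∉ closure C := by
  have hφv := hC.pos_of_ne hv hv0
  set T : Set ℝ := {t | u - t • v ∈ closure C} with hT
  have hcl : IsClosed T :=
    isClosed_closure.preimage (by fun_prop : Continuous fun t : ℝ => u - t • v)
  have h0 : (0 : ℝ) ∈ T := by simpa [hT] using hu
  have hbdd : BddAbove T := by
    refine ⟨φ u / φ v, fun t ht => ?_⟩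
    have := hC.nonneg ht
    rw [map_sub, map_smul, smul_eq_mul] at this
    rw [le_div_iff₀ hφv]
    linarith
  refine ⟨sSup T, le_csSup hbdd h0, hcl.csSup_mem ⟨0, h0⟩ hbdd, fun s hs h => ?_⟩
  exact absurd (le_csSup hbdd h) (not_le.2 hs)

/-- A sharp cone with thin triangles is strictly convex. -/
theorem IsSharpCone.isStrictCone [FiniteDimensional ℝ E] {φ : E →ₗ[ℝ] ℝ} {C : Set E}
    (hC : IsSharpCone φ C) {δ : ℝ} (ht : IsThin C δ) : IsStrictCone C := by
  intro u hu v hv hli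
  by_contra! hcon
  rw [LinearIndependent.pair_iff] at hli
  have hv0 : v ≠ 0 := fun h => by simpa using hli 0 1 (by simp [h])
  have hnot : ∀ s t : ℝ, 0 < s → 0 < t → s • u + t • v ∉ C := by
    intro s t hs ht h
    refine hcon _ ⟨s / (s + t), t / (s + t), by positivity, by positivity, by field_simp, rfl⟩ ?_
    have := hC.smul_mem _ h (s + t)⁻¹ (by positivity)
    convert this using 1
    rw [smul_add, smul_smul, smul_smul]
    ring_nf
  -- Extend the boundary segment to a maximal one: a and b span the extreme rays of the section of
  -- the closed cone by the plane of u and v.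
  obtain ⟨τ, hτ0, hτ, hτmax⟩ := hC.exists_extremal hu hv hv0
  set a := u - τ • v with ha
  have ha0 : a ≠ 0 := fun h => by simpa using hli 1 (-τ) (by rw [← h, ha]; module)
  obtain ⟨σ, hσ0, hσ, hσmax⟩ := hC.exists_extremal hv hτ ha0
  set b := v - σ • a with hb
  have hb0 : b ≠ 0 := fun h => by
    have := hli (-σ) (1 + σ * τ) (by rw [← h, hb, ha]; module)
    have h1 : σ = 0 := by linarith [this.1]
    have h2 := this.2
    rw [h1] at h2
    norm_num at h2
  have hba : ∀ s : ℝ, 0 < s → b - s • a ∉ closure C := fun s hs h =>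
    hσmax (σ + s) (by linarith) (by convert h using 1; rw [hb]; module)
  have hab : ∀ s : ℝ, 0 < s → a - s • b ∉ closure C := by
    intro s hs h
    -- Since a - s b = (1 + sσ) a - s v, dividing by 1 + sσ gives u - (τ + s/(1 + sσ)) v.
    refine hτmax (τ + s / (1 + s * σ)) (by have : 0 < s / (1 + s * σ) := by positivity
                                           linarith) ?_
    have h2 := hC.smul_mem_closure h (t := (1 + s * σ)⁻¹) (by positivity)
    have h1 : (1 + s * σ) ≠ 0 := by positivity
    convert h2 using 1
    rw [hb, show a - s • (v - σ • a) = (1 + s * σ) • a - s • v by module, smul_sub,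
      inv_smul_smul₀ h1, ha]
    module
  -- Because u + v = (a + b) + σ a + τ v, an interior a + b would make u + v interior.
  have habC : a + b ∉ C := by
    intro h
    have := hC.add_mem_of_mem_closure (hC.add_mem_of_mem_closure h
      (hC.smul_mem_closure' hτ hσ0)) (hC.smul_mem_closure' hv hτ0)
    refine hnot 1 1 one_pos one_pos ?_
    convert this using 1
    rw [hb, ha]
    module
  obtain ⟨z, hz⟩ := hC.nonempty
  let 𝒰 : Ultrafilter ℕ := hyperfilter ℕ
  have hlim0 : Tendsto (fun n : ℕ => ((n : ℝ) + 1)⁻¹) 𝒰 (𝓝 0) :=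
    (tendsto_inv_atTop_zero.comp
      (tendsto_atTop_add_const_right _ 1 tendsto_natCast_atTop_atTop)).mono_left
      Nat.hyperfilter_le_atTop
  set x : ℕ → E := fun n => a + ((n : ℝ) + 1)⁻¹ • z with hx
  set y : ℕ → E := fun n => b + ((n : ℝ) + 1)⁻¹ • z with hy
  have hxC : ∀ n, x n ∈ C := fun n => by
    change a + _ ∈ C
    rw [add_comm]
    exact hC.add_mem_of_mem_closure (hC.smul_mem z hz _ (by positivity)) hτ
  have hyC : ∀ n, y n ∈ C := fun n => by
    change b + _ ∈ C
    rw [add_comm]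
    exact hC.add_mem_of_mem_closure (hC.smul_mem z hz _ (by positivity)) hσ
  have hxlim : Tendsto x 𝒰 (𝓝 a) := by simpa using (hlim0.smul_const z).const_add a
  have hylim : Tendsto y 𝒰 (𝓝 b) := by simpa using (hlim0.smul_const z).const_add b
  have hφab : 0 < φ (a + b) := by
    rw [map_add]
    linarith [hC.pos_of_ne hτ ha0, hC.pos_of_ne hσ hb0]
  -- a limit of points of the segments from `z` to `q n → c`
  have key : ∀ (q : ℕ → E) (c : E), c ∈ closure C → c ≠ 0 → Tendsto q 𝒰 (𝓝 c) →
      (∀ᶠ n in 𝒰, ∃ v ∈ segment ℝ z (q n), ConeClose C δ (x n + y n) v) →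
      ConeClose C δ (a + b) c := by
    intro q c hc hc0 hq hex
    have hex' : ∀ᶠ n in 𝒰, ∃ s : ℝ, s ∈ Icc (0 : ℝ) 1 ∧
        ConeClose C δ (x n + y n) (AffineMap.lineMap z (q n) s) := by
      filter_upwards [hex] with n ⟨v, hv, hv'⟩
      rw [segment_eq_image_lineMap] at hv
      obtain ⟨s, hs, rfl⟩ := hv
      exact ⟨s, hs, hv'⟩
    obtain ⟨s, hs⟩ := hex'.choice
    obtain ⟨s₀, hs₀, hslim⟩ :=
      exists_tendsto_of_eventually_mem isCompact_Icc (hs.mono fun i hi => hi.1)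
    have hlim : Tendsto (fun n => AffineMap.lineMap z (q n) (s n)) 𝒰
        (𝓝 (AffineMap.lineMap z c s₀)) := by
      simp only [AffineMap.lineMap_apply_module]
      exact ((hslim.const_sub 1).smul_const z).add (hslim.smul hq)
    have hmem : s₀ < 1 → AffineMap.lineMap z c s₀ ∈ C := by
      intro h1
      rw [AffineMap.lineMap_apply_module]
      exact hC.add_mem_of_mem_closure (hC.smul_mem _ hz _ (by linarith))
        (hC.smul_mem_closure' hc hs₀.1)
    have hpos : 0 < φ (AffineMap.lineMap z c s₀) := by
      rcases hs₀.2.lt_or_eq with h1 | h1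
      · exact hC.pos (hmem h1)
      · rw [h1, AffineMap.lineMap_apply_one]
        exact hC.pos_of_ne hc hc0
    have hclose : ConeClose C δ (a + b) (AffineMap.lineMap z c s₀) :=
      (isConeLimit_const 𝒰 C).coneClose (φ := φ)
        (Eventually.of_forall fun _ v hv => (hC.pos hv).le) (hxlim.add hylim) hlim hφab hpos
        (hs.mono fun i hi => hi.2)
    rcases hs₀.2.lt_or_eq with h1 | h1
    -- For s₀ < 1 the limit point is interior, and β (a + b) minus it is in the closed cone, which
    -- would make a + b interior.
    · exfalso
      obtain ⟨α, β, hα, hβ, h2, h3, -⟩ := hclose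
      have := hC.smul_mem _ (hC.add_mem_of_mem_closure (hmem h1) h3) β⁻¹ (by positivity)
      rw [add_sub_cancel, inv_smul_smul₀ hβ.ne'] at this
      exact habC this
    · rwa [h1, AffineMap.lineMap_apply_one] at hclose
  -- no boundary point of the section is at bounded distance from its interior
  have fin : ∀ c e : E, c ∈ closure C → e ∈ closure C → e ≠ 0 →
      (∀ s : ℝ, 0 < s → c - s • e ∉ closure C) → ¬ ConeClose C δ (e + c) c := by
    rintro c e hc he he0 hce ⟨α, β, hα, hβ, h2, h3, -⟩
    -- From α c - (e + c) in the closed cone: if α ≤ 1, adding (1 - α) c gives -e; if α > 1,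
    -- dividing by α - 1 contradicts the extremality of c.
    rcases le_or_gt α 1 with h1 | h1
    · refine he0 (hC.eq_zero he ?_)
      have := hC.add_mem_closure h2 (hC.smul_mem_closure' hc (t := 1 - α) (by linarith))
      convert this using 1
      module
    · refine hce (α - 1)⁻¹ (by rw [inv_pos]; linarith) ?_
      have h4 : α - 1 ≠ 0 := by linarith
      have := hC.smul_mem_closure h2 (t := (α - 1)⁻¹) (by rw [inv_pos]; linarith)
      convert this using 1
      rw [show α • c - (e + c) = (α - 1) • c - e by module, smul_sub, inv_smul_smul₀ h4]
  have hall : ∀ᶠ n in 𝒰, (∃ v ∈ segment ℝ z (y n), ConeClose C δ (x n + y n) v) ∨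
      ∃ v ∈ segment ℝ z (x n), ConeClose C δ (x n + y n) v := by
    refine Eventually.of_forall fun n => ?_
    obtain ⟨w, hw | hw, hw'⟩ := ht _ (hxC n) _ (hyC n) z hz
    · exact Or.inl ⟨w, by rwa [segment_symm], hw'⟩
    · exact Or.inr ⟨w, hw, hw'⟩
  rcases Ultrafilter.eventually_or.1 hall with h1 | h1
  · exact fin b a hσ hτ ha0 hba (key y b hσ hb0 hylim h1)
  · have := key x a hτ ha0 hxlim h1
    rw [add_comm] at this
    exact fin a b hτ hσ hb0 hab this

end Limit

/-! ### Normalisation of a pointed cone (Benzécri) -/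

section Benzecri

open Matrix

variable {n : ℕ}

theorem exists_eq_dotProduct (g : (Fin n → ℝ) →ₗ[ℝ] ℝ) : ∃ p : Fin n → ℝ, ∀ v, g v = p ⬝ᵥ v := by
  refine ⟨fun i => g fun j => if i = j then 1 else 0, fun v => ?_⟩
  rw [LinearMap.pi_apply_eq_sum_univ g v, dotProduct]
  exact Finset.sum_congr rfl fun i _ => mul_comm _ _

/-- The normalised functionals which are nonnegative on `C`. -/
def dualBase (C : Set (Fin n → ℝ)) (u : Fin n → ℝ) : Set (Fin n → ℝ) :=
  {p | p ⬝ᵥ u = 1 ∧ ∀ v ∈ C, 0 ≤ p ⬝ᵥ v}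

/-- As u is interior, u + ε w ∈ C for some ε > 0, so p · w ≥ -1/ε; taking w = ±eᵢ bounds every
coordinate of p. -/
theorem isCompact_dualBase {C : Set (Fin n → ℝ)} (hC : IsOpen C) {u : Fin n → ℝ} (hu : u ∈ C) :
    IsCompact (dualBase C u) := by
  have hcont : ∀ v : Fin n → ℝ, Continuous fun p : Fin n → ℝ => p ⬝ᵥ v := fun v =>
    Continuous.dotProduct continuous_id continuous_const
  have hcl : IsClosed (dualBase C u) := by
    have : dualBase C u = {p | p ⬝ᵥ u = 1} ∩ ⋂ v ∈ C, {p | 0 ≤ p ⬝ᵥ v} := by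
      ext p
      simp [dualBase]
    rw [this]
    exact (isClosed_eq (hcont u) continuous_const).inter
      (isClosed_biInter fun v _ => isClosed_le continuous_const (hcont v))
  have hex : ∀ w : Fin n → ℝ, ∃ ε : ℝ, 0 < ε ∧ u + ε • w ∈ C := by
    intro w
    have h : Tendsto (fun ε : ℝ => u + ε • w) (𝓝[>] 0) (𝓝 u) := by
      have : Continuous fun ε : ℝ => u + ε • w := by fun_prop
      simpa using (this.tendsto 0).mono_left nhdsWithin_le_nhds
    have h1 : ∀ᶠ ε in 𝓝[>] (0 : ℝ), u + ε • w ∈ C := h (hC.mem_nhds hu)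
    obtain ⟨ε, hε, h0⟩ := (h1.and (self_mem_nhdsWithin (s := Ioi (0 : ℝ)))).exists
    exact ⟨ε, h0, hε⟩
  choose ε hε hεC using hex
  have hbd : ∀ p ∈ dualBase C u, ∀ w, -(1 / ε w) ≤ p ⬝ᵥ w := by
    intro p hp w
    have := hp.2 _ (hεC w)
    rw [dotProduct_add, dotProduct_smul, hp.1, smul_eq_mul] at this
    rw [neg_le, le_div_iff₀ (hε w)]
    linarith
  refine (isCompact_Icc (a := fun i : Fin n => -(1 / ε (Pi.single i 1)))
    (b := fun i : Fin n => 1 / ε (-Pi.single i 1))).of_isClosed_subset hcl fun p hp => ⟨?_, ?_⟩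
  · intro i
    simpa using hbd p hp (Pi.single i 1)
  · intro i
    have := hbd p hp (-Pi.single i 1)
    rw [dotProduct_neg, dotProduct_single, mul_one] at this
    exact neg_le_neg_iff.1 this

/-- Sharpness puts φ in the interior of the dual cone: φ remains positive on C after adding a small
multiple of any coordinate form. -/
theorem span_dualBase {φ : (Fin n → ℝ) →ₗ[ℝ] ℝ} {C : Set (Fin n → ℝ)} (hC : IsSharpCone φ C)
    {u : Fin n → ℝ} (hu : u ∈ C) : Submodule.span ℝ (dualBase C u) = ⊤ := by
  obtain ⟨p, hp⟩ := exists_eq_dotProduct φ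
  obtain ⟨c, hc, hbound⟩ := hC.bound
  have key : ∀ q : Fin n → ℝ, (∀ v ∈ C, 0 ≤ q ⬝ᵥ v) → 0 < q ⬝ᵥ u →
      q ∈ Submodule.span ℝ (dualBase C u) := by
    intro q hq hqu
    have h : (q ⬝ᵥ u)⁻¹ • q ∈ dualBase C u := by
      refine ⟨by rw [smul_dotProduct, smul_eq_mul, inv_mul_cancel₀ hqu.ne'], fun v hv => ?_⟩
      rw [smul_dotProduct, smul_eq_mul]
      exact mul_nonneg (inv_nonneg.2 hqu.le) (hq v hv)
    have := Submodule.smul_mem _ (q ⬝ᵥ u) (Submodule.subset_span (R := ℝ) h)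
    rwa [smul_inv_smul₀ hqu.ne'] at this
  have hp1 : p ∈ Submodule.span ℝ (dualBase C u) :=
    key p (fun v hv => hp v ▸ (hC.pos hv).le) (hp u ▸ hC.pos hu)
  have hlow : ∀ (i : Fin n), ∀ v ∈ C, 0 < (p + (c / 2) • Pi.single i 1) ⬝ᵥ v := by
    intro i v hv
    rw [add_dotProduct, smul_dotProduct, single_dotProduct, ← hp, one_mul, smul_eq_mul]
    have h1 := hbound v hv
    have h2 := norm_le_pi_norm v i
    have h3 := hC.pos hv
    have h4 := neg_abs_le (v i)
    rw [Real.norm_eq_abs] at h2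
    nlinarith
  have hsingle : ∀ i : Fin n, (Pi.single i 1 : Fin n → ℝ) ∈ Submodule.span ℝ (dualBase C u) := by
    intro i
    have h1 := key _ (fun v hv => (hlow i v hv).le) (hlow i u hu)
    have h2 := Submodule.smul_mem _ (2 / c) (Submodule.sub_mem _ h1 hp1)
    rw [add_sub_cancel_left, smul_smul, div_mul_div_cancel₀ hc.ne', div_self two_ne_zero,
      one_smul] at h2
    exact h2
  rw [eq_top_iff, ← (Pi.basisFun ℝ (Fin n)).span_eq, Submodule.span_le]
  rintro _ ⟨i, rfl⟩
  rw [Pi.basisFun_apply]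
  exact hsingle i

/-- A pointed sharp cone can be moved by a linear automorphism so that the point becomes
`(1, …, 1)` and the cone lies between a fixed ball around this point and the orthant. -/
theorem IsSharpCone.exists_normalization {φ : (Fin n → ℝ) →ₗ[ℝ] ℝ} {C : Set (Fin n → ℝ)}
    (hC : IsSharpCone φ C) {u : Fin n → ℝ} (hu : u ∈ C) :
    ∃ A : GL (Fin n) ℝ, A • u = 1 ∧ (∀ v ∈ C, ∀ i, 0 ≤ (A • v) i) ∧
      ∀ v, ∑ i, |(A • v) i - 1| < 1 → v ∈ C := by
  have hcomp := isCompact_dualBase hC.isOpen hu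
  obtain ⟨f₀, hf₀, hdet₀⟩ : ∃ f : Fin n → Fin n → ℝ, (∀ i, f i ∈ dualBase C u) ∧
      (Matrix.of f).det ≠ 0 := by
    have hrank : Module.finrank ℝ (Submodule.span ℝ (dualBase C u)) = n := by
      rw [span_dualBase hC hu, finrank_top, Module.finrank_fin_fun]
    have := Submodule.exists_fun_fin_finrank_span_eq ℝ (dualBase C u)
    rw [hrank] at this
    obtain ⟨f, hf, -, hli⟩ := this
    refine ⟨f, hf, ?_⟩
    have h2 := linearIndependent_rows_iff_isUnit (A := Matrix.of f).1 hli
    exact ((Matrix.isUnit_iff_isUnit_det _).1 h2).ne_zero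
  -- The rows of A are normalised dual vectors of maximal determinant, as in the construction of an
  -- Auerbach basis.
  obtain ⟨f, hf, hmax⟩ := (isCompact_univ_pi fun _ : Fin n => hcomp).exists_isMaxOn
    ⟨f₀, fun i _ => hf₀ i⟩ (f := fun f => |(Matrix.of f).det|)
    (Continuous.matrix_det (by exact continuous_id)).abs.continuousOn
  set A := Matrix.of f with hA
  have hdet : 0 < |A.det| := (abs_pos.2 hdet₀).trans_le (hmax (a := f₀) fun i _ => hf₀ i)
  have hdet' : IsUnit A.det := isUnit_iff_ne_zero.2 (abs_pos.1 hdet)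
  have hAv : ∀ v i, (A *ᵥ v) i = f i ⬝ᵥ v := fun v i => rfl
  refine ⟨Matrix.GeneralLinearGroup.mk'' A hdet', ?_, ?_, ?_⟩
  · funext i
    exact (hf i trivial).1
  · intro v hv i
    exact (hf i trivial).2 v hv
  · intro v hv
    by_contra hvC
    obtain ⟨g, hg, hgv⟩ := hC.exists_functional hC.nonempty hvC
    obtain ⟨p, hp⟩ := exists_eq_dotProduct (g : (Fin n → ℝ) →ₗ[ℝ] ℝ)
    have hp' : ∀ v, g v = p ⬝ᵥ v := hp
    have hgu := hg u hu
    set q := (g u)⁻¹ • p with hq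
    have hqv : ∀ v, q ⬝ᵥ v = (g u)⁻¹ * g v := fun v => by
      rw [hq, smul_dotProduct, hp' v, smul_eq_mul]
    have hqB : q ∈ dualBase C u :=
      ⟨by rw [hqv, inv_mul_cancel₀ hgu.ne'], fun v hv => by
        rw [hqv]
        exact mul_nonneg (inv_nonneg.2 hgu.le) (hg v hv).le⟩
    set c := q ᵥ* A⁻¹ with hc
    have hqc : q = ∑ k, c k • A k := by
      rw [← vecMul_eq_sum, hc, vecMul_vecMul, Matrix.nonsing_inv_mul _ hdet', vecMul_one]
    -- Replacing row j by q multiplies the determinant by c j, so maximality bounds c j. Together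
    -- with ∑ c = 1 this gives q · v > 0 on the prescribed neighbourhood.
    have hc1 : ∀ j, |c j| ≤ 1 := by
      intro j
      have h1 := Matrix.det_updateRow_sum A j c
      rw [← hqc] at h1
      have h2 : |(A.updateRow j q).det| ≤ |A.det| := by
        refine hmax (a := A.updateRow j q) fun i _ => ?_
        by_cases hij : i = j
        · subst hij
          rw [Matrix.updateRow_self]
          exact hqB
        · rw [Matrix.updateRow_ne hij]
          exact hf i trivial
      rw [h1, smul_eq_mul, abs_mul] at h2
      exact (mul_le_iff_le_one_left hdet).1 h2
    have hqdot : ∀ w, q ⬝ᵥ w = ∑ k, c k * (A *ᵥ w) k := by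
      intro w
      rw [hqc, sum_dotProduct]
      refine Finset.sum_congr rfl fun k _ => ?_
      rw [smul_dotProduct, smul_eq_mul]
      rfl
    have hsum : ∑ k, c k = 1 := by
      rw [← hqB.1, hqdot]
      refine Finset.sum_congr rfl fun k _ => ?_
      rw [hAv, (hf k trivial).1, mul_one]
    have h1 : q ⬝ᵥ v = 1 + ∑ k, c k * ((A *ᵥ v) k - 1) := by
      simp only [hqdot, mul_sub, mul_one, Finset.sum_sub_distrib, hsum]
      ring
    have h2 : |∑ k, c k * ((A *ᵥ v) k - 1)| < 1 := by
      refine lt_of_le_of_lt ((Finset.abs_sum_le_sum_abs _ _).trans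
        (Finset.sum_le_sum fun k _ => ?_)) hv
      rw [abs_mul]
      exact mul_le_of_le_one_left (abs_nonneg _) (hc1 k)
    have h3 : q ⬝ᵥ v ≤ 0 := by
      rw [hqv]
      exact mul_nonpos_of_nonneg_of_nonpos (inv_nonneg.2 hgu.le) hgv
    linarith [(abs_lt.1 h2).1]

end Benzecri

/-! ### Cones over subsets of the projective space -/

section ConeOver

open Matrix

variable {d : ℕ}

/-- The part of the cone over `S` on which `φ` is positive. -/
def coneOver (φ : Module.Dual ℝ (Vec d)) (S : Set (ProjSpace d)) : Set (Vec d) :=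
  {v | 0 < φ v ∧ ∃ h : v ≠ 0, Projectivization.mk ℝ v h ∈ S}

variable {φ : Module.Dual ℝ (Vec d)} {S : Set (ProjSpace d)}

theorem ne_zero_of_apply_ne {v : Vec d} (h : φ v ≠ 0) : v ≠ 0 := fun h0 => h (by simp [h0])

theorem mk_smul_eq {v : Vec d} (hv : v ≠ 0) {t : ℝ} (ht : t ≠ 0) :
    Projectivization.mk ℝ (t • v) (smul_ne_zero ht hv) = Projectivization.mk ℝ v hv := by
  rw [Projectivization.mk_eq_mk_iff']
  exact ⟨t, rfl⟩

theorem mk_neg_eq {v : Vec d} (hv : v ≠ 0) :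
    Projectivization.mk ℝ (-v) (neg_ne_zero.2 hv) = Projectivization.mk ℝ v hv := by
  rw [Projectivization.mk_eq_mk_iff']
  exact ⟨-1, by module⟩

theorem continuous_mk' :
    Continuous (Projectivization.mk' ℝ : {v : Vec d // v ≠ 0} → ProjSpace d) :=
  continuous_coinduced_rng

theorem isOpen_setOf_mk_mem (hS : IsOpen S) :
    IsOpen {v : Vec d | ∃ h : v ≠ 0, Projectivization.mk ℝ v h ∈ S} := by
  have h1 := (isOpen_compl_singleton (x := (0 : Vec d))).isOpenMap_subtype_val _
    (hS.preimage continuous_mk')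
  convert h1 using 1
  ext v
  constructor
  · rintro ⟨h, hv⟩
    exact ⟨⟨v, h⟩, hv, rfl⟩
  · rintro ⟨⟨w, h⟩, hw, rfl⟩
    exact ⟨h, hw⟩

theorem continuous_dual (φ : Module.Dual ℝ (Vec d)) : Continuous φ :=
  LinearMap.continuous_of_finiteDimensional φ

theorem isOpen_coneOver (hS : IsOpen S) : IsOpen (coneOver φ S) :=
  (isOpen_lt continuous_const (continuous_dual φ)).inter (isOpen_setOf_mk_mem hS)

theorem smul_mem_coneOver {v : Vec d} (hv : v ∈ coneOver φ S) {t : ℝ} (ht : 0 < t) :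
    t • v ∈ coneOver φ S := by
  obtain ⟨h1, h2, h3⟩ := hv
  refine ⟨by rw [map_smul]; exact mul_pos ht h1, smul_ne_zero ht.ne' h2, ?_⟩
  rwa [mk_smul_eq h2 ht.ne']

theorem apply_affineCoord {x : ProjSpace d} (hx : x ∈ affineChart φ) :
    φ (affineCoord φ x) = 1 := by
  rw [affineCoord, map_smul, smul_eq_mul, inv_mul_cancel₀ hx]

theorem affineCoord_ne_zero {x : ProjSpace d} (hx : x ∈ affineChart φ) : affineCoord φ x ≠ 0 :=
  ne_zero_of_apply_ne (φ := φ) (by rw [apply_affineCoord hx]; exact one_ne_zero)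

theorem mk_affineCoord {x : ProjSpace d} (hx : x ∈ affineChart φ) :
    Projectivization.mk ℝ (affineCoord φ x) (affineCoord_ne_zero hx) = x := by
  conv_rhs => rw [← x.mk_rep]
  exact mk_smul_eq x.rep_nonzero (inv_ne_zero hx)

theorem affineCoord_mem_coneOver_iff {x : ProjSpace d} (hx : x ∈ affineChart φ) :
    affineCoord φ x ∈ coneOver φ S ↔ x ∈ S := by
  constructor
  · rintro ⟨-, h, h'⟩
    rwa [mk_affineCoord hx] at h'
  · intro h
    refine ⟨by rw [apply_affineCoord hx]; exact one_pos, affineCoord_ne_zero hx, ?_⟩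
    rwa [mk_affineCoord hx]

theorem affineCoord_image (hS : S ⊆ affineChart φ) :
    affineCoord φ '' S = {v ∈ coneOver φ S | φ v = 1} := by
  ext v
  constructor
  · rintro ⟨x, hx, rfl⟩
    exact ⟨(affineCoord_mem_coneOver_iff (hS hx)).2 hx, apply_affineCoord (hS hx)⟩
  · rintro ⟨⟨-, h0, h⟩, h1⟩
    exact ⟨_, h, by rw [affineCoord_mk, h1, inv_one, one_smul]⟩

theorem inv_smul_mem_image {v : Vec d} (hS : S ⊆ affineChart φ) (hv : v ∈ coneOver φ S) :
    (φ v)⁻¹ • v ∈ affineCoord φ '' S := by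
  rw [affineCoord_image hS]
  refine ⟨smul_mem_coneOver hv (inv_pos.2 hv.1), ?_⟩
  rw [map_smul, smul_eq_mul, inv_mul_cancel₀ hv.1.ne']

/-- The sum u + v is φ u + φ v times a convex combination of the normalised vectors. A bound R for S
in the chart gives the sharpness constant 1/R. -/
theorem isSharpCone_coneOver (hS : IsOpen S) (hne : S.Nonempty) (hsub : S ⊆ affineChart φ)
    (hconv : Convex ℝ (affineCoord φ '' S)) (hbdd : Bornology.IsBounded (affineCoord φ '' S)) :
    IsSharpCone φ (coneOver φ S) := by
  have hadd : ∀ u ∈ coneOver φ S, ∀ v ∈ coneOver φ S, u + v ∈ coneOver φ S := by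
    intro u hu v hv
    have h1 := inv_smul_mem_image hsub hu
    have h2 := inv_smul_mem_image hsub hv
    have hu0 := hu.1
    have hv0 := hv.1
    have h3 := hconv h1 h2 (a := φ u / (φ u + φ v)) (b := φ v / (φ u + φ v))
      (by positivity) (by positivity) (by field_simp)
    rw [affineCoord_image hsub] at h3
    have h4 := smul_mem_coneOver h3.1 (t := φ u + φ v) (by positivity)
    convert h4 using 1
    rw [smul_add, smul_smul, smul_smul, smul_smul, smul_smul]
    have h5 : φ u + φ v ≠ 0 := by positivity
    congr 1
    · rw [show (φ u + φ v) * (φ u / (φ u + φ v)) * (φ u)⁻¹ = 1 by field_simp, one_smul]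
    · rw [show (φ u + φ v) * (φ v / (φ u + φ v)) * (φ v)⁻¹ = 1 by field_simp, one_smul]
  have hsmul : ∀ v ∈ coneOver φ S, ∀ t : ℝ, 0 < t → t • v ∈ coneOver φ S := fun v hv t ht =>
    smul_mem_coneOver hv ht
  refine ⟨⟨isOpen_coneOver hS, ?_, hsmul⟩, ?_, fun h => h.2.1 rfl, ?_⟩
  · intro u hu v hv a b ha hb hab
    rcases ha.eq_or_lt with rfl | ha
    · rw [zero_add] at hab
      simpa [hab] using hv
    rcases hb.eq_or_lt with rfl | hb
    · rw [add_zero] at hab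
      simpa [hab] using hu
    exact hadd _ (hsmul u hu a ha) _ (hsmul v hv b hb)
  · obtain ⟨x, hx⟩ := hne
    exact ⟨_, (affineCoord_mem_coneOver_iff (hsub hx)).2 hx⟩
  · obtain ⟨R, hR0, hR⟩ := hbdd.exists_pos_norm_le
    refine ⟨R⁻¹, inv_pos.2 hR0, fun v hv => ?_⟩
    have := hR _ (inv_smul_mem_image hsub hv)
    rw [norm_smul, norm_inv, Real.norm_of_nonneg hv.1.le, inv_mul_le_iff₀ hv.1] at this
    rw [inv_mul_le_iff₀ hR0]
    linarith

/-- The cone of a convex body in its distinguished chart. -/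
theorem ConvexBody.isSharpCone_chart (Ω : ConvexBody d) :
    IsSharpCone Ω.chart (coneOver Ω.chart Ω.carrier) :=
  isSharpCone_coneOver Ω.isOpen Ω.nonempty Ω.properlyConvex.choose_spec.2.1
    Ω.properlyConvex.choose_spec.2.2.1 Ω.properlyConvex.choose_spec.2.2.2

theorem ConvexBody.subset_chart (Ω : ConvexBody d) : Ω.carrier ⊆ affineChart Ω.chart :=
  Ω.properlyConvex.choose_spec.2.1

/-- The cones over a convex body in two charts agree up to sign. -/
theorem coneOver_eq_or_neg {ψ : Module.Dual ℝ (Vec d)} (hC : IsOpenCone (coneOver φ S))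
    (hφ : S ⊆ affineChart φ) (hψ : S ⊆ affineChart ψ) :
    coneOver ψ S = coneOver φ S ∨ coneOver ψ S = -coneOver φ S := by
  have hne : ∀ v ∈ coneOver φ S, ψ v ≠ 0 := by
    rintro v ⟨-, h0, hv⟩
    exact (mk_mem_affineChart ψ v h0).1 (hψ hv)
  have hsign : ∀ v, v ∈ coneOver ψ S → v ∈ coneOver φ S ∨ -v ∈ coneOver φ S := by
    rintro v ⟨-, h0, hv⟩
    rcases lt_or_gt_of_ne ((mk_mem_affineChart φ v h0).1 (hφ hv)) with h | h
    · refine Or.inr ⟨by rw [map_neg]; linarith, neg_ne_zero.2 h0, ?_⟩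
      rwa [mk_neg_eq h0]
    · exact Or.inl ⟨h, h0, hv⟩
  have hneg : ∀ v : Vec d, 0 < ψ v → -v ∈ coneOver φ S → v ∈ coneOver ψ S := by
    rintro v hv ⟨-, h0, h⟩
    have h0' : v ≠ 0 := neg_ne_zero.1 h0
    refine ⟨hv, h0', ?_⟩
    rwa [mk_neg_eq h0'] at h
  by_cases hpos : ∃ u ∈ coneOver φ S, 0 < ψ u
  · obtain ⟨u, hu, hψu⟩ := hpos
    have hall : ∀ v ∈ coneOver φ S, 0 < ψ v := by
      intro v hv
      by_contra! h
      have h' := lt_of_le_of_ne h (hne v hv)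
      -- If ψ took both signs, ψ(u) v - ψ(v) u would be a vector of the cone annihilated by ψ.
      have := hne _ (hC.add_mem (hC.smul_mem v hv (ψ u) hψu) (hC.smul_mem u hu (-ψ v)
        (by linarith)))
      refine this ?_
      rw [map_add, map_smul, map_smul, smul_eq_mul, smul_eq_mul]
      ring
    left
    ext v
    constructor
    · intro hv
      rcases hsign v hv with h | h
      · exact h
      · have := hall _ h
        rw [map_neg] at this
        linarith [hv.1]
    · intro hv
      exact ⟨hall v hv, hv.2⟩
  · push Not at hpos
    right
    ext v
    constructor
    · intro hv
      rcases hsign v hv with h | h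
      · linarith [hv.1, hpos v h]
      · exact h
    · intro hv
      refine hneg v ?_ hv
      have h1 := hpos _ hv
      have h2 := hne _ hv
      rw [map_neg] at h1 h2
      exact lt_of_le_of_ne (by linarith) fun h => h2 (by rw [← h, neg_zero])

/-! #### Continuity of the affine coordinates -/

/-- The functional `φ` as a vector. -/
def dualVec (φ : Module.Dual ℝ (Vec d)) : Vec d := (exists_eq_dotProduct φ).choose

theorem dualVec_dotProduct (φ : Module.Dual ℝ (Vec d)) (v : Vec d) : φ v = dualVec φ ⬝ᵥ v :=
  (exists_eq_dotProduct φ).choose_spec v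

/-- Projecting the vector of φ onto a line of the chart of φ gives a nonzero vector of that line
depending continuously on it, unlike `rep`. Continuity of `affineCoord` follows. -/
theorem projMatrix_mulVec (v : Vec d) :
    Matrix.of (projMatrix v) *ᵥ dualVec φ = (φ v / (v ⬝ᵥ v)) • v := by
  funext i
  rw [Pi.smul_apply, smul_eq_mul, dualVec_dotProduct, Matrix.mulVec, dotProduct, dotProduct,
    Finset.sum_div, Finset.sum_mul]
  refine Finset.sum_congr rfl fun j _ => ?_
  simp only [Matrix.of_apply, projMatrix]
  ring

theorem continuous_lineMatrix' : Continuous (lineMatrix : ProjSpace d → _) :=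
  continuous_lineMatrix

theorem continuous_lineMatrix_mulVec :
    Continuous fun x : ProjSpace d => Matrix.of (lineMatrix x) *ᵥ dualVec φ :=
  Continuous.matrix_mulVec (by exact continuous_lineMatrix') continuous_const

theorem apply_lineMatrix (x : ProjSpace d) :
    φ (Matrix.of (lineMatrix x) *ᵥ dualVec φ) = φ x.rep * φ x.rep / (x.rep ⬝ᵥ x.rep) := by
  rw [lineMatrix, projMatrix_mulVec, map_smul, smul_eq_mul]
  ring

theorem rep_dotProduct_ne (x : ProjSpace d) : x.rep ⬝ᵥ x.rep ≠ 0 := fun h =>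
  x.rep_nonzero (dotProduct_self_eq_zero.1 h)

theorem mem_affineChart_iff (x : ProjSpace d) :
    x ∈ affineChart φ ↔ φ (Matrix.of (lineMatrix x) *ᵥ dualVec φ) ≠ 0 := by
  rw [apply_lineMatrix, div_ne_zero_iff, mul_self_ne_zero]
  exact ⟨fun h => ⟨h, rep_dotProduct_ne x⟩, fun h => h.1⟩

theorem isOpen_affineChart : IsOpen (affineChart φ) := by
  have : affineChart φ = {x | φ (Matrix.of (lineMatrix x) *ᵥ dualVec φ) ≠ 0} :=
    Set.ext mem_affineChart_iff
  rw [this]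
  exact isOpen_ne_fun ((continuous_dual φ).comp continuous_lineMatrix_mulVec) continuous_const

theorem continuousOn_affineCoord : ContinuousOn (affineCoord φ) (affineChart φ) := by
  have h : EqOn (affineCoord φ) (fun x => (φ (Matrix.of (lineMatrix x) *ᵥ dualVec φ))⁻¹ •
      (Matrix.of (lineMatrix x) *ᵥ dualVec φ)) (affineChart φ) := by
    intro x hx
    have h1 : φ x.rep ≠ 0 := hx
    have h2 := rep_dotProduct_ne x
    simp only [apply_lineMatrix]
    rw [lineMatrix, projMatrix_mulVec, smul_smul, affineCoord]
    congr 1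
    field_simp
  have h1 : ContinuousOn (fun x => (φ (Matrix.of (lineMatrix x) *ᵥ dualVec φ))⁻¹)
      (affineChart φ) :=
    ((continuous_dual φ).comp continuous_lineMatrix_mulVec).continuousOn.inv₀
      fun x hx => (mem_affineChart_iff x).1 hx
  exact (h1.smul continuous_lineMatrix_mulVec.continuousOn).congr h

/-! #### Closures -/

/-- Away from φ = 0, the map x ↦ φ v • `affineCoord φ x` is a continuous section through v with
values in the cone over S. -/
theorem mem_closure_coneOver_iff (hS : S ⊆ affineChart φ) {v : Vec d} (hv : 0 < φ v) :
    v ∈ closure (coneOver φ S) ↔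
      Projectivization.mk ℝ v (ne_zero_of_apply_ne hv.ne') ∈ closure S := by
  have hv0 := ne_zero_of_apply_ne hv.ne'
  constructor
  · intro h
    rw [mem_closure_iff] at h ⊢
    intro U hU hvU
    obtain ⟨w, ⟨_, h2⟩, _, _, h3⟩ := h _ (isOpen_setOf_mk_mem hU) ⟨hv0, hvU⟩
    exact ⟨_, h2, h3⟩
  · intro h
    have hx : Projectivization.mk ℝ v hv0 ∈ affineChart φ :=
      (mk_mem_affineChart φ v hv0).2 hv.ne'
    have hc : ContinuousWithinAt (fun x => φ v • affineCoord φ x) S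
        (Projectivization.mk ℝ v hv0) :=
      (((continuousOn_affineCoord.continuousAt (isOpen_affineChart.mem_nhds hx))).const_smul
        (φ v)).continuousWithinAt
    have := hc.mem_closure h (t := coneOver φ S) fun x hx =>
      smul_mem_coneOver ((affineCoord_mem_coneOver_iff (hS hx)).2 hx) hv
    rwa [affineCoord_mk, smul_inv_smul₀ hv.ne'] at this

theorem zero_mem_closure_coneOver (hne : S.Nonempty) (hS : S ⊆ affineChart φ) :
    (0 : Vec d) ∈ closure (coneOver φ S) := by
  obtain ⟨x, hx⟩ := hne
  have h : Tendsto (fun t : ℝ => t • affineCoord φ x) (𝓝[>] 0) (𝓝 0) := by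
    have : Continuous fun t : ℝ => t • affineCoord φ x := by fun_prop
    simpa using (this.tendsto 0).mono_left nhdsWithin_le_nhds
  refine mem_closure_of_tendsto h ?_
  filter_upwards [self_mem_nhdsWithin] with t ht
  exact smul_mem_coneOver ((affineCoord_mem_coneOver_iff (hS hx)).2 hx) ht

theorem nonneg_of_mem_closure_coneOver {v : Vec d} (hv : v ∈ closure (coneOver φ S)) :
    0 ≤ φ v :=
  closure_minimal (t := {v | 0 ≤ φ v}) (fun _ h => h.1.le)
    (isClosed_le continuous_const (continuous_dual φ)) hv

theorem IsSharpCone.closure_coneOver (hC : IsSharpCone φ (coneOver φ S))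
    (hS : S ⊆ affineChart φ) :
    closure (coneOver φ S) = insert 0 (coneOver φ (closure S)) := by
  ext v
  rw [mem_insert_iff]
  constructor
  · intro hv
    by_cases h0 : v = 0
    · exact Or.inl h0
    · have h1 := hC.pos_of_ne hv h0
      exact Or.inr ⟨h1, h0, (mem_closure_coneOver_iff hS h1).1 hv⟩
  · rintro (rfl | ⟨h1, h2, h3⟩)
    · exact hC.zero_mem_closure
    · exact (mem_closure_coneOver_iff hS h1).2 h3

/-- A segment of the closed cone missing the open cone projects to a segment of the frontier; linear
independence keeps it away from the apex. -/
theorem isStrictCone_of_isStrictlyConvex {Ω : ConvexBody d} (hΩ : Ω.IsStrictlyConvex)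
    (hC : IsSharpCone φ (coneOver φ Ω.carrier)) (hsub : Ω.carrier ⊆ affineChart φ) :
    IsStrictCone (coneOver φ Ω.carrier) := by
  intro u hu v hv hli
  by_contra! hcon
  refine hΩ ⟨u, v, hli, fun w hw => ?_⟩
  have hwcl : w ∈ closure (coneOver φ Ω.carrier) := by
    obtain ⟨a, b, ha, hb, -, rfl⟩ := hw
    exact hC.add_mem_closure (hC.smul_mem_closure' hu ha) (hC.smul_mem_closure' hv hb)
  have hw0 : w ≠ 0 := by
    rintro rfl
    obtain ⟨a, b, ha, hb, hab, h0⟩ := hw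
    have := LinearIndependent.pair_iff.1 hli a b h0
    linarith [this.1, this.2]
  have hpos := hC.pos_of_ne hwcl hw0
  refine ⟨hw0, ?_⟩
  rw [frontier, Ω.isOpen.interior_eq]
  exact ⟨(mem_closure_coneOver_iff hsub hpos).1 hwcl, fun h => hcon w hw ⟨hpos, hw0, h⟩⟩

/-- Every sharp open cone is the cone over a convex body. -/
theorem IsSharpCone.exists_convexBody {C : Set (Vec d)} (hC : IsSharpCone φ C) :
    ∃ Ω : ConvexBody d, Ω.carrier ⊆ affineChart φ ∧ coneOver φ Ω.carrier = C := by
  set S : Set (ProjSpace d) := {x | x ∈ affineChart φ ∧ affineCoord φ x ∈ C} with hS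
  have hsub : S ⊆ affineChart φ := fun x hx => hx.1
  have hcone : coneOver φ S = C := by
    ext v
    constructor
    · rintro ⟨h1, h2, h3, h4⟩
      rw [affineCoord_mk] at h4
      have := hC.smul_mem _ h4 _ h1
      rwa [smul_inv_smul₀ h1.ne'] at this
    · intro hv
      have h1 := hC.pos hv
      have h2 := ne_zero_of_apply_ne h1.ne'
      refine ⟨h1, h2, (mk_mem_affineChart φ v h2).2 h1.ne', ?_⟩
      rw [affineCoord_mk]
      exact hC.smul_mem _ hv _ (inv_pos.2 h1)
  have himg := affineCoord_image hsub
  rw [hcone] at himg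
  obtain ⟨v₀, hv₀⟩ := hC.nonempty
  have hv₀' := hcone.symm ▸ hv₀
  refine ⟨⟨S, ?_, ⟨_, hv₀'.2.2⟩, φ, ?_, hsub, ?_, ?_⟩, hsub, hcone⟩
  · exact continuousOn_affineCoord.isOpen_inter_preimage isOpen_affineChart hC.isOpen
  · rintro rfl
    simpa using hC.pos hv₀
  · rw [himg]
    intro u hu v hv a b ha hb hab
    refine ⟨hC.convex hu.1 hv.1 ha hb hab, ?_⟩
    rw [map_add, map_smul, map_smul, hu.2, hv.2, smul_eq_mul, smul_eq_mul, mul_one, mul_one, hab]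
  · obtain ⟨c, hc, hb⟩ := hC.bound
    rw [himg, isBounded_iff_forall_norm_le]
    refine ⟨c⁻¹, fun v hv => ?_⟩
    have := hb v hv.1
    rw [hv.2] at this
    rw [← one_div, le_div_iff₀ hc]
    linarith

/-! #### Limits in the Hausdorff topology -/

/-- Take nearest points; the distance from x to a compact set is continuous in the set. -/
theorem exists_tendsto_of_mem {X ι : Type*} [MetricSpace X] {l : Filter ι}
    {K : ι → NonemptyCompacts X} {K₀ : NonemptyCompacts X} (h : Tendsto K l (𝓝 K₀)) {x : X}
    (hx : x ∈ K₀) : ∃ y : ι → X, (∀ i, y i ∈ K i) ∧ Tendsto y l (𝓝 x) := by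
  have h1 : Tendsto (fun i => Metric.infDist x (K i)) l (𝓝 (Metric.infDist x K₀)) :=
    ((Metric.lipschitz_infDist_set x).continuous.tendsto K₀).comp h
  rw [Metric.infDist_zero_of_mem (show x ∈ (K₀ : Set X) from hx)] at h1
  have h2 : ∀ i, ∃ y ∈ (K i : Set X), Metric.infDist x (K i) = dist x y := fun i =>
    (K i).isCompact.exists_infDist_eq_dist (K i).nonempty x
  choose y hy hy' using h2
  refine ⟨y, hy, tendsto_iff_dist_tendsto_zero.2 ?_⟩
  simpa only [hy', dist_comm] using h1

/-- Hausdorff convergence of the closures becomes Kuratowski convergence of the cones. The limit K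
is an arbitrary compact subset of the chart, as the second part needs this before K is known to be
the closure of a body. -/
theorem isConeLimit_coneOver {ι : Type*} {𝒰 : Ultrafilter ι} {Ω : ι → ConvexBody d}
    {K : NonemptyCompacts (ProjSpace d)} (h : Tendsto (fun i => (Ω i).closure) 𝒰 (𝓝 K))
    (hK : (K : Set (ProjSpace d)) ⊆ affineChart φ)
    (hΩ : ∀ᶠ i in 𝒰, (Ω i).carrier ⊆ affineChart φ) :
    IsConeLimit 𝒰 (fun i => coneOver φ (Ω i).carrier) (insert 0 (coneOver φ K)) where
  exists_lim := by
    rintro v (rfl | ⟨h1, h2, h3⟩)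
    · exact ⟨fun _ => 0, hΩ.mono fun i hi => zero_mem_closure_coneOver (Ω i).nonempty hi,
        tendsto_const_nhds⟩
    · obtain ⟨y, hy, hlim⟩ := exists_tendsto_of_mem h h3
      have hx := hK h3
      have hcont : Tendsto (fun i => φ v • affineCoord φ (y i)) 𝒰
          (𝓝 (φ v • affineCoord φ (Projectivization.mk ℝ v h2))) :=
        (((continuousOn_affineCoord.continuousAt
          (isOpen_affineChart.mem_nhds hx)).tendsto.comp hlim)).const_smul _
      rw [affineCoord_mk, smul_inv_smul₀ h1.ne'] at hcont
      refine ⟨_, ?_, hcont⟩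
      filter_upwards [hΩ, hlim (isOpen_affineChart.mem_nhds hx)] with i hi hi'
      have hφ : φ (φ v • affineCoord φ (y i)) = φ v := by
        rw [map_smul, apply_affineCoord hi', smul_eq_mul, mul_one]
      rw [mem_closure_coneOver_iff hi (hφ.symm ▸ h1)]
      have := hy i
      rw [← mk_affineCoord hi', ← mk_smul_eq (affineCoord_ne_zero hi') h1.ne'] at this
      exact this
  mem_of_lim := by
    intro w v hw hlim
    by_cases h0 : v = 0
    · exact Or.inl h0
    right
    have hmem : Projectivization.mk ℝ v h0 ∈ K := by
      have hex : ∀ᶠ i in 𝒰, w i ≠ 0 := hlim (isOpen_compl_singleton.mem_nhds h0)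
      by_contra hcon
      -- Separate the limit line from K: eventually the closures lie in V while the line of w i lies
      -- in U. As w i is only in the closed cone, it is first moved into the open one.
      obtain ⟨U, V, hU, hV, hUv, hVK, hUV⟩ :=
        SeparatedNhds.of_isCompact_isCompact (isCompact_singleton (x := Projectivization.mk ℝ v h0))
          K.isCompact (disjoint_singleton_left.2 hcon)
      have h1 : ∀ᶠ i in 𝒰, ((Ω i).closure : Set (ProjSpace d)) ⊆ V :=
        h ((NonemptyCompacts.isOpen_subsets_of_isOpen hV).mem_nhds hVK)
      have h2 : ∀ᶠ i in 𝒰, w i ∈ {v : Vec d | ∃ h : v ≠ 0, Projectivization.mk ℝ v h ∈ U} :=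
        hlim ((isOpen_setOf_mk_mem hU).mem_nhds ⟨h0, hUv rfl⟩)
      obtain ⟨i, hi1, hi2, hi3⟩ := (h1.and (h2.and hw)).exists
      obtain ⟨a, ha, -, ha0, ha'⟩ := mem_closure_iff.1 hi3 _ (isOpen_setOf_mk_mem hU) hi2
      obtain ⟨_, ha⟩ := ha
      exact hUV.le_bot ⟨ha, hi1 (subset_closure ha')⟩
    have h1 : φ v ≠ 0 := (mk_mem_affineChart φ v h0).1 (hK hmem)
    have h2 : 0 ≤ φ v := ge_of_tendsto (((continuous_dual φ).tendsto v).comp hlim)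
      (hw.mono fun i hi => nonneg_of_mem_closure_coneOver hi)
    exact ⟨lt_of_le_of_ne h2 h1.symm, h0, hmem⟩

end ConeOver

/-! ### The Hilbert distance in terms of the gauge -/

section Distance

theorem eq_Ioo_of_isOpen {I : Set ℝ} (ho : IsOpen I) (hc : I.OrdConnected) (hne : I.Nonempty)
    (hb : BddBelow I) (ha : BddAbove I) : I = Ioo (sInf I) (sSup I) := by
  have hbelow : sInf I ∉ I := fun h => by
    have h1 : ∀ᶠ y in 𝓝[<] sInf I, y ∈ I := nhdsWithin_le_nhds (ho.mem_nhds h)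
    obtain ⟨y, hy, hlt⟩ := (h1.and (self_mem_nhdsWithin (s := Iio (sInf I)))).exists
    exact absurd (csInf_le hb hy) (not_le.2 hlt)
  have habove : sSup I ∉ I := fun h => by
    have h1 : ∀ᶠ y in 𝓝[>] sSup I, y ∈ I := nhdsWithin_le_nhds (ho.mem_nhds h)
    obtain ⟨y, hy, hlt⟩ := (h1.and (self_mem_nhdsWithin (s := Ioi (sSup I)))).exists
    exact absurd (le_csSup ha hy) (not_le.2 hlt)
  refine Subset.antisymm (fun t ht => ⟨?_, ?_⟩) ?_
  · exact lt_of_le_of_ne (csInf_le hb ht) fun h => hbelow (h ▸ ht)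
  · exact lt_of_le_of_ne (le_csSup ha ht) fun h => habove (h ▸ ht)
  · rintro t ⟨h1, h2⟩
    obtain ⟨u, hu, hut⟩ := exists_lt_of_csInf_lt hne h1
    obtain ⟨v, hv, htv⟩ := exists_lt_of_lt_csSup hne h2
    exact hc.out hu hv ⟨hut.le, htv.le⟩

variable {E : Type*} [NormedAddCommGroup E] [NormedSpace ℝ E]

theorem IsOpenCone.smul_notMem {C : Set E} (hC : IsOpenCone C) {v : E} (hv : v ∉ C) {t : ℝ}
    (ht : 0 < t) : t • v ∉ C := fun h => hv <| by
  have := hC.smul_mem _ h t⁻¹ (inv_pos.2 ht)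
  rwa [inv_smul_smul₀ ht.ne'] at this

/-- The line through `x` and `y` meets the cone in the points with parameter in `(a, b)`. -/
structure IsChord (C : Set E) (x y : E) (a b : ℝ) : Prop where
  neg : a < 0
  one_lt : 1 < b
  mem_iff : ∀ t, AffineMap.lineMap x y t ∈ C ↔ t ∈ Ioo a b
  left_mem : AffineMap.lineMap x y a ∈ closure C
  right_mem : AffineMap.lineMap x y b ∈ closure C

variable {φ : E →ₗ[ℝ] ℝ} {C : Set E} {x y z : E}

theorem IsSharpCone.isChord (hC : IsSharpCone φ C) (hx : x ∈ C) (hy : y ∈ C) (hxy : x ≠ y)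
    (hφ : φ x = φ y) : IsChord C x y (sInf {t : ℝ | AffineMap.lineMap x y t ∈ C})
      (sSup {t : ℝ | AffineMap.lineMap x y t ∈ C}) := by
  set I : Set ℝ := {t | AffineMap.lineMap x y t ∈ C} with hI
  have hcont : Continuous fun t : ℝ => AffineMap.lineMap x y t := AffineMap.lineMap_continuous
  have ho : IsOpen I := hC.isOpen.preimage hcont
  have hconv : Convex ℝ I := hC.convex.affine_preimage (AffineMap.lineMap x y)
  have h0 : (0 : ℝ) ∈ I := by simpa [hI] using hx
  have h1 : (1 : ℝ) ∈ I := by simpa [hI] using hy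
  -- Here φ is constant on the line because φ x = φ y, so sharpness bounds the norm of its points in
  -- C.
  have hbdd : Bornology.IsBounded I := by
    obtain ⟨c, hc, hb⟩ := hC.bound
    rw [isBounded_iff_forall_norm_le]
    refine ⟨(φ x / c + ‖x‖) / dist x y, fun t ht => ?_⟩
    have hd : 0 < dist x y := dist_pos.2 hxy
    rw [le_div_iff₀ hd, ← dist_lineMap_left, dist_eq_norm]
    refine (norm_sub_le _ _).trans (add_le_add ?_ le_rfl)
    have h2 := hb _ ht
    rw [AffineMap.lineMap_apply_module, map_add, map_smul, map_smul, ← hφ, ← add_smul,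
      sub_add_cancel, one_smul] at h2
    rw [AffineMap.lineMap_apply_module, le_div_iff₀ hc]
    linarith
  have heq := eq_Ioo_of_isOpen ho hconv.ordConnected ⟨0, h0⟩ hbdd.bddBelow hbdd.bddAbove
  have hcl : ∀ t ∈ closure I, AffineMap.lineMap x y t ∈ closure C := fun t ht =>
    map_mem_closure hcont ht fun s hs => hs
  have h0' := h0
  have h1' := h1
  rw [heq] at h0' h1'
  refine ⟨h0'.1, h1'.2, fun t => ?_, hcl _ (csInf_mem_closure ⟨0, h0⟩ hbdd.bddBelow),
    hcl _ (csSup_mem_closure ⟨0, h0⟩ hbdd.bddAbove)⟩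
  rw [← heq]
  rfl

theorem IsSharpCone.coneGauge_self (hC : IsSharpCone φ C) (hx : x ∈ C) : coneGauge C x x = 1 :=
  hC.coneGauge_eq hx (by simpa using hC.zero_mem_closure) (by simpa using hC.zero_notMem)

namespace IsChord

variable {a b s t : ℝ}

/-- With this coefficient the difference is a positive multiple of the endpoint at b, hence a
boundary vector. -/
theorem coneGauge_right (h : IsChord C x y a b) (hC : IsSharpCone φ C) (hs : a < s) (hst : s < t)
    (ht : t < b) :
    coneGauge C (AffineMap.lineMap x y s) (AffineMap.lineMap x y t) = (b - s) / (b - t) := by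
  have hbt : 0 < b - t := sub_pos.2 ht
  have key : ((b - s) / (b - t)) • (AffineMap.lineMap x y t : E) - AffineMap.lineMap x y s =
      ((t - s) / (b - t)) • (AffineMap.lineMap x y b : E) := by
    simp only [AffineMap.lineMap_apply_module']
    match_scalars <;> field_simp <;> ring
  have hpos : 0 < (t - s) / (b - t) := div_pos (sub_pos.2 hst) hbt
  refine hC.coneGauge_eq ((h.mem_iff t).2 ⟨hs.trans hst, ht⟩) ?_ ?_
  · rw [key]
    exact hC.smul_mem_closure h.right_mem hpos
  · rw [key]
    exact hC.smul_notMem (fun h' => lt_irrefl _ ((h.mem_iff b).1 h').2) hpos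

theorem coneGauge_left (h : IsChord C x y a b) (hC : IsSharpCone φ C) (hs : a < s) (hst : s < t)
    (ht : t < b) :
    coneGauge C (AffineMap.lineMap x y t) (AffineMap.lineMap x y s) = (t - a) / (s - a) := by
  have has : 0 < s - a := sub_pos.2 hs
  have key : ((t - a) / (s - a)) • (AffineMap.lineMap x y s : E) - AffineMap.lineMap x y t =
      ((t - s) / (s - a)) • (AffineMap.lineMap x y a : E) := by
    simp only [AffineMap.lineMap_apply_module']
    match_scalars <;> field_simp <;> ring
  have hpos : 0 < (t - s) / (s - a) := div_pos (sub_pos.2 hst) has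
  refine hC.coneGauge_eq ((h.mem_iff s).2 ⟨hs, hst.trans ht⟩) ?_ ?_
  · rw [key]
    exact hC.smul_mem_closure h.left_mem hpos
  · rw [key]
    exact hC.smul_notMem (fun h' => lt_irrefl _ ((h.mem_iff a).1 h').1) hpos

end IsChord

/-! ### Arclength along a chord -/

/-- The Hilbert distance of two points of a cone. -/
def coneDist (C : Set E) (x y : E) : ℝ := 1 / 2 * Real.log (coneGauge C x y * coneGauge C y x)

theorem coneDist_comm (C : Set E) (x y : E) :
    coneDist C x y = coneDist C y x := by
  rw [coneDist, coneDist, mul_comm (coneGauge C x y)]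

/-- The arclength parameter of a chord with end points `a` and `b`. -/
def chordLength (a b t : ℝ) : ℝ := 1 / 2 * Real.log ((t - a) / (b - t))

/-- The inverse of `chordLength`. -/
def chordPoint (a b g : ℝ) : ℝ := (a + b * Real.exp (2 * g)) / (1 + Real.exp (2 * g))

theorem chordPoint_mem {a b : ℝ} (hab : a < b) (g : ℝ) : chordPoint a b g ∈ Ioo a b := by
  have h := Real.exp_pos (2 * g)
  rw [chordPoint]
  constructor
  · rw [lt_div_iff₀ (by positivity)]
    nlinarith
  · rw [div_lt_iff₀ (by positivity)]
    nlinarith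

theorem chordLength_chordPoint {a b : ℝ} (hab : a < b) (g : ℝ) :
    chordLength a b (chordPoint a b g) = g := by
  have h := Real.exp_pos (2 * g)
  have h1 : (chordPoint a b g - a) / (b - chordPoint a b g) = Real.exp (2 * g) := by
    have h2 := sub_pos.2 (chordPoint_mem hab g).2
    rw [div_eq_iff h2.ne', chordPoint]
    field_simp
    ring
  rw [chordLength, h1, Real.log_exp]
  ring

theorem chordPoint_chordLength {a b t : ℝ} (ht : t ∈ Ioo a b) :
    chordPoint a b (chordLength a b t) = t := by
  have h1 := sub_pos.2 ht.1
  have h2 := sub_pos.2 ht.2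
  have h3 : 2 * chordLength a b t = Real.log ((t - a) / (b - t)) := by
    rw [chordLength]
    ring
  have h4 : b - t + (t - a) ≠ 0 := by linarith
  rw [chordPoint, h3, Real.exp_log (by positivity)]
  field_simp
  ring_nf

theorem chordPoint_strictMono {a b : ℝ} (hab : a < b) : StrictMono (chordPoint a b) := by
  intro g h hgh
  have h1 := Real.exp_pos (2 * g)
  have h2 := Real.exp_pos (2 * h)
  have h3 : Real.exp (2 * g) < Real.exp (2 * h) := Real.exp_lt_exp.2 (by linarith)
  rw [chordPoint, chordPoint, div_lt_div_iff₀ (by positivity) (by positivity)]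
  nlinarith

theorem chordLength_le {a b s t : ℝ} (hs : s ∈ Ioo a b) (ht : t ∈ Ioo a b) (hst : s ≤ t) :
    chordLength a b s ≤ chordLength a b t := by
  rw [← (chordPoint_strictMono (hs.1.trans hs.2)).le_iff_le, chordPoint_chordLength hs,
    chordPoint_chordLength ht]
  exact hst

theorem IsChord.coneDist_eq_of_lt {a b s t : ℝ} (h : IsChord C x y a b) (hC : IsSharpCone φ C)
    (hs : a < s) (hst : s < t) (ht : t < b) :
    coneDist C (AffineMap.lineMap x y s) (AffineMap.lineMap x y t) =
      chordLength a b t - chordLength a b s := by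
  have h1 := sub_pos.2 hs
  have h2 := sub_pos.2 ht
  have h3 := sub_pos.2 (hs.trans hst)
  have h4 := sub_pos.2 (hst.trans ht)
  rw [coneDist, h.coneGauge_right hC hs hst ht, h.coneGauge_left hC hs hst ht, chordLength,
    chordLength, ← mul_sub, ← Real.log_div (by positivity) (by positivity)]
  congr 2
  field_simp

theorem IsChord.coneDist_eq {a b s t : ℝ} (h : IsChord C x y a b) (hC : IsSharpCone φ C)
    (hs : s ∈ Ioo a b) (ht : t ∈ Ioo a b) :
    coneDist C (AffineMap.lineMap x y s) (AffineMap.lineMap x y t) =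
      |chordLength a b s - chordLength a b t| := by
  rcases lt_trichotomy s t with hst | rfl | hst
  · rw [h.coneDist_eq_of_lt hC hs.1 hst ht.2, abs_sub_comm, abs_of_nonneg]
    exact sub_nonneg.2 (chordLength_le hs ht hst.le)
  · rw [coneDist, hC.coneGauge_self ((h.mem_iff s).2 hs)]
    simp
  · rw [coneDist_comm, h.coneDist_eq_of_lt hC ht.1 hst hs.2, abs_of_nonneg]
    exact sub_nonneg.2 (chordLength_le ht hs hst.le)

/-! ### Equality in the triangle inequality -/

/-- In a strictly convex cone, the equality case of the triangle inequality forces the middle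
point to lie on the segment. -/
theorem IsSharpCone.mem_segment_of_coneDist_eq [FiniteDimensional ℝ E] (hC : IsSharpCone φ C)
    (hstrict : IsStrictCone C) (hx : x ∈ C) (hy : y ∈ C) (hz : z ∈ C) (hφx : φ x = 1)
    (hφy : φ y = 1) (hφz : φ z = 1) (h : coneDist C x z = coneDist C x y + coneDist C y z) : y ∈ segment ℝ x z := by
  have hxy := hC.coneGauge_pos hx hy
  have hyx := hC.coneGauge_pos hy hx
  have hyz := hC.coneGauge_pos hy hz
  have hzy := hC.coneGauge_pos hz hy
  have hxz := hC.coneGauge_pos hx hz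
  have hzx := hC.coneGauge_pos hz hx
  have htri : ∀ u v w : E, v ∈ C → w ∈ C → 0 < coneGauge C u v →
      coneGauge C u w ≤ coneGauge C u v * coneGauge C v w := by
    intro u v w hv hw hpos
    refine hC.coneGauge_le hw ?_
    have := hC.add_mem_closure (hC.coneGauge_mem_closure u hv)
      (hC.smul_mem_closure (hC.coneGauge_mem_closure v hw) hpos)
    convert this using 1
    module
  have hprod : coneGauge C x z * coneGauge C z x =
      (coneGauge C x y * coneGauge C y z) * (coneGauge C z y * coneGauge C y x) := by
    rw [coneDist, coneDist, coneDist, ← mul_add, ← Real.log_mul (by positivity) (by positivity)]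
      at h
    have h2 := Real.log_injOn_pos (mem_Ioi.2 (by positivity)) (mem_Ioi.2 (by positivity))
      (mul_left_cancel₀ (by norm_num) h)
    rw [h2]
    ring
  -- Both multiplicative triangle inequalities hold, and their product is an equality, so each is
  -- one.
  have heq : coneGauge C x z = coneGauge C x y * coneGauge C y z := by
    refine le_antisymm (htri x y z hy hz hxy) ?_
    by_contra! hlt
    have h1 := mul_lt_mul hlt (htri z y x hy hx hzy) hzx (by positivity)
    rw [hprod] at h1
    exact lt_irrefl _ h1
  set α := coneGauge C x y with hα
  set β := coneGauge C y z with hβ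
  set p := α • y - x with hp
  set q := β • z - y with hq
  have hpcl : p ∈ closure C := hC.coneGauge_mem_closure x hy
  have hqcl : q ∈ closure C := hC.coneGauge_mem_closure y hz
  have hnot : p + α • q ∉ C := by
    have := hC.coneGauge_notMem x hz
    rwa [heq, show (α * β) • z - x = p + α • q by rw [hp, hq]; module] at this
  have hφp : φ p = α - 1 := by rw [hp, map_sub, map_smul, hφx, hφy, smul_eq_mul, mul_one]
  have hφq : φ q = β - 1 := by rw [hq, map_sub, map_smul, hφz, hφy, smul_eq_mul, mul_one]
  -- The boundary vector M(x/z) z - x equals p + α q with p, q in the closed cone; independent p and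
  -- q would make it interior. Removing `min 1 α` times the interior point w leaves nonnegative
  -- coefficients.
  have hli : ¬ LinearIndependent ℝ ![p, q] := by
    intro hli
    obtain ⟨w, ⟨s, t, hs, ht, hst, rfl⟩, hw⟩ := hstrict p hpcl q hqcl hli
    refine hnot ?_
    have hk : 0 < min 1 α := lt_min one_pos hxy
    have hs1 : s ≤ 1 := by linarith
    have ht1 : t ≤ 1 := by linarith
    have h1 : min 1 α * s ≤ 1 := by nlinarith [min_le_left 1 α]
    have h2 : min 1 α * t ≤ α := by nlinarith [min_le_right 1 α]
    have := hC.add_mem_of_mem_closure (hC.add_mem_of_mem_closure (hC.smul_mem _ hw _ hk)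
      (hC.smul_mem_closure' hpcl (sub_nonneg.2 h1))) (hC.smul_mem_closure' hqcl (sub_nonneg.2 h2))
    convert this using 1
    module
  by_cases hp0 : p = 0
  · have h1 : α = 1 := by
      rw [hp0, map_zero] at hφp
      linarith
    rw [hp, h1, one_smul, sub_eq_zero] at hp0
    rw [hp0]
    exact left_mem_segment ℝ x z
  by_cases hq0 : q = 0
  · have h1 : β = 1 := by
      rw [hq0, map_zero] at hφq
      linarith
    rw [hq, h1, one_smul, sub_eq_zero] at hq0
    rw [hq0]
    exact right_mem_segment ℝ x y
  have hα1 : 0 < α - 1 := hφp ▸ hC.pos_of_ne hpcl hp0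
  have hβ1 : 0 < β - 1 := hφq ▸ hC.pos_of_ne hqcl hq0
  have hpar : (β - 1) • p = (α - 1) • q := by
    rw [LinearIndependent.pair_iff] at hli
    push Not at hli
    obtain ⟨s, t, hst, hne⟩ := hli
    have h1 : s * (α - 1) + t * (β - 1) = 0 := by
      have := congrArg φ hst
      rwa [map_add, map_smul, map_smul, hφp, hφq, map_zero, smul_eq_mul, smul_eq_mul] at this
    have hs : s ≠ 0 := by
      intro hs
      rw [hs, zero_mul, zero_add] at h1
      exact hne hs ((mul_eq_zero.1 h1).resolve_right hβ1.ne')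
    refine smul_right_injective E hs ?_
    calc s • (β - 1) • p = (β - 1) • (s • p + t • q) - (t * (β - 1)) • q := by module
      _ = s • (α - 1) • q := by
        rw [hst, show t * (β - 1) = -(s * (α - 1)) by linarith]
        module
  have hden : 0 < α * β - 1 := by nlinarith
  -- Expanding p and q in `hpar` gives (αβ - 1) y = (β - 1) x + (α - 1) β z.
  refine ⟨(β - 1) / (α * β - 1), (α - 1) * β / (α * β - 1), by positivity, by positivity, ?_, ?_⟩
  · rw [← add_div, div_eq_one_iff_eq hden.ne']
    ring
  · have h1 : (α * β - 1) • y = (β - 1) • x + ((α - 1) * β) • z := by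
      have h2 : (β - 1) • p + (β - 1) • x + (α - 1) • y =
          (α - 1) • q + (β - 1) • x + (α - 1) • y := by rw [hpar]
      rw [hp, hq] at h2
      calc (α * β - 1) • y = (β - 1) • (α • y - x) + (β - 1) • x + (α - 1) • y := by module
        _ = (α - 1) • (β • z - y) + (β - 1) • x + (α - 1) • y := h2
        _ = (β - 1) • x + ((α - 1) * β) • z := by module
    refine smul_right_injective E hden.ne' ?_
    change (α * β - 1) • _ = (α * β - 1) • y
    rw [h1, smul_add, smul_smul, smul_smul, mul_div_cancel₀ _ hden.ne', mul_div_cancel₀ _ hden.ne']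

end Distance

/-! ### Geodesics of a convex body -/

/-- Lets one change the representatives of the end points of a side. -/
theorem exists_smul_mem_segment {E : Type*} [AddCommGroup E] [Module ℝ E] {a b : ℝ} (ha : 0 < a)
    (hb : 0 < b) {y z v : E} (hv : v ∈ segment ℝ (a • y) (b • z)) :
    ∃ c : ℝ, 0 < c ∧ c • v ∈ segment ℝ y z := by
  obtain ⟨s, t, hs, ht, hst, rfl⟩ := hv
  have hpos : 0 < s * a + t * b := by
    rcases hs.eq_or_lt with rfl | hs
    · rw [zero_add] at hst
      rw [hst]
      linarith
    · have : 0 ≤ t * b := by positivity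
      have : 0 < s * a := by positivity
      linarith
  refine ⟨(s * a + t * b)⁻¹, inv_pos.2 hpos, s * a / (s * a + t * b), t * b / (s * a + t * b),
    by positivity, by positivity, ?_, ?_⟩
  · rw [← add_div, div_self hpos.ne']
  · rw [smul_add, smul_smul, smul_smul, smul_smul, smul_smul, div_eq_inv_mul, div_eq_inv_mul]
    ring_nf

namespace ConvexBody

variable {d : ℕ} (Ω : ConvexBody d)

/-- The cone over a convex body in its distinguished chart. -/
def cone : Set (Vec d) := coneOver Ω.chart Ω.carrier

/-- The affine coordinate of a point of a convex body in its distinguished chart. -/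
def coord (x : Ω.carrier) : Vec d := affineCoord Ω.chart x

variable {Ω}

theorem isSharpCone : IsSharpCone Ω.chart Ω.cone := Ω.isSharpCone_chart

theorem coord_mem (x : Ω.carrier) : Ω.coord x ∈ Ω.cone :=
  (affineCoord_mem_coneOver_iff (Ω.subset_chart x.2)).2 x.2

theorem chart_coord (x : Ω.carrier) : Ω.chart (Ω.coord x) = 1 :=
  apply_affineCoord (Ω.subset_chart x.2)

theorem coord_injective : Function.Injective Ω.coord := by
  intro x y h
  apply Subtype.ext
  rw [← mk_affineCoord (Ω.subset_chart x.2), ← mk_affineCoord (Ω.subset_chart y.2)]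
  congr 1

/-- The point of a convex body represented by a vector of its cone. -/
def point (v : Vec d) (hv : v ∈ Ω.cone) : Ω.carrier := ⟨_, hv.2.2⟩

theorem coord_point {v : Vec d} (hv : v ∈ Ω.cone) :
    Ω.coord (point v hv) = (Ω.chart v)⁻¹ • v :=
  affineCoord_mk _ _ _

/-- Lengths on the line are parameter differences times |xy|, a factor that cancels in the
cross-ratio. -/
theorem hilbertDist_eq (x y : Ω.carrier) :
    Ω.hilbertDist x y = coneDist Ω.cone (Ω.coord x) (Ω.coord y) := by
  by_cases hxy : x = y
  · subst hxy
    rw [hilbertDist, hilbertDistIn, if_pos rfl, coneDist, isSharpCone.coneGauge_self (coord_mem x)]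
    simp
  have hne : Ω.coord x ≠ Ω.coord y := fun h => hxy (coord_injective h)
  have hφ : Ω.chart (Ω.coord x) = Ω.chart (Ω.coord y) := by rw [chart_coord, chart_coord]
  have hI : {t : ℝ | AffineMap.lineMap (Ω.coord x) (Ω.coord y) t ∈
      affineCoord Ω.chart '' Ω.carrier} =
      {t : ℝ | AffineMap.lineMap (Ω.coord x) (Ω.coord y) t ∈ Ω.cone} := by
    rw [affineCoord_image Ω.subset_chart]
    ext t
    refine ⟨fun h => h.1, fun h => ⟨h, ?_⟩⟩
    rw [AffineMap.lineMap_apply_module, map_add, map_smul, map_smul, chart_coord, chart_coord,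
      ← add_smul, sub_add_cancel, one_smul]
  have hchord := isSharpCone.isChord (coord_mem x) (coord_mem y) hne hφ
  have h := hchord.coneDist_eq_of_lt isSharpCone hchord.neg one_pos hchord.one_lt
  rw [AffineMap.lineMap_apply_zero, AffineMap.lineMap_apply_one] at h
  rw [h, hilbertDist, hilbertDistIn, if_neg fun h => hxy (Subtype.ext h)]
  change 1 / 2 * Real.log (dist (AffineMap.lineMap (Ω.coord x) (Ω.coord y) (sInf {t : ℝ |
      AffineMap.lineMap (Ω.coord x) (Ω.coord y) t ∈ affineCoord Ω.chart '' Ω.carrier}))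
      (Ω.coord y) * dist (AffineMap.lineMap (Ω.coord x) (Ω.coord y) (sSup {t : ℝ |
      AffineMap.lineMap (Ω.coord x) (Ω.coord y) t ∈ affineCoord Ω.chart '' Ω.carrier}))
      (Ω.coord x) / (dist (AffineMap.lineMap (Ω.coord x) (Ω.coord y) (sInf {t : ℝ |
      AffineMap.lineMap (Ω.coord x) (Ω.coord y) t ∈ affineCoord Ω.chart '' Ω.carrier}))
      (Ω.coord x) * dist (AffineMap.lineMap (Ω.coord x) (Ω.coord y) (sSup {t : ℝ |
      AffineMap.lineMap (Ω.coord x) (Ω.coord y) t ∈ affineCoord Ω.chart '' Ω.carrier}))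
      (Ω.coord y))) = _
  rw [hI]
  revert hchord
  generalize sInf {t : ℝ | AffineMap.lineMap (Ω.coord x) (Ω.coord y) t ∈ Ω.cone} = a
  generalize sSup {t : ℝ | AffineMap.lineMap (Ω.coord x) (Ω.coord y) t ∈ Ω.cone} = b
  intro hchord
  have ha := hchord.neg
  have hb := hchord.one_lt
  have hd : 0 < dist (Ω.coord x) (Ω.coord y) := dist_pos.2 hne
  have h0 : (0 : ℝ) < 0 - a := by linarith
  have h1 : (0 : ℝ) < 1 - a := by linarith
  have h2 : (0 : ℝ) < b - 0 := by linarith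
  have h3 : (0 : ℝ) < b - 1 := by linarith
  rw [dist_lineMap_right, dist_lineMap_right, dist_lineMap_left, dist_lineMap_left,
    Real.norm_of_nonneg h1.le, Real.norm_of_nonpos ha.le, Real.norm_of_nonneg (by linarith : 0 ≤ b),
    Real.norm_of_nonpos (by linarith : 1 - b ≤ 0), chordLength, chordLength, ← mul_sub,
    ← Real.log_div (by positivity) (by positivity)]
  congr 2
  have h4 : -(1 - b) = b - 1 := by ring
  rw [h4, sub_zero, zero_sub] at *
  have ha' : a ≠ 0 := ha.ne
  field_simp

theorem hilbertDist_le_iff {δ : ℝ} (x y : Ω.carrier) :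
    Ω.hilbertDist x y ≤ δ ↔ ConeClose Ω.cone δ (Ω.coord x) (Ω.coord y) := by
  rw [hilbertDist_eq, isSharpCone.coneClose_iff (coord_mem x) (coord_mem y), coneDist]

/-- The straight segment between two points. -/
def straight (x y : Ω.carrier) : Set Ω.carrier :=
  {w | Ω.coord w ∈ segment ℝ (Ω.coord x) (Ω.coord y)}

theorem isGeodesic_straight (x y : Ω.carrier) : IsGeodesic Ω.hilbertDist x y (straight x y) := by
  by_cases hxy : x = y
  · subst hxy
    have h0 : Ω.hilbertDist x x = 0 := by rw [hilbertDist, hilbertDistIn, if_pos rfl]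
    refine ⟨fun _ => x, rfl, rfl, ?_, ?_⟩
    · rw [h0]
      intro s hs t ht
      rw [Icc_self, mem_singleton_iff] at hs ht
      simp [hs, ht, h0]
    · ext w
      rw [h0, Icc_self, image_singleton, mem_singleton_iff, straight, segment_same, mem_ofPred_eq,
        mem_singleton_iff, coord_injective.eq_iff]
  have hne : Ω.coord x ≠ Ω.coord y := fun h => hxy (coord_injective h)
  have hφ : Ω.chart (Ω.coord x) = Ω.chart (Ω.coord y) := by rw [chart_coord, chart_coord]
  have hchord := isSharpCone.isChord (coord_mem x) (coord_mem y) hne hφ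
  revert hchord
  generalize sInf {t : ℝ | AffineMap.lineMap (Ω.coord x) (Ω.coord y) t ∈ Ω.cone} = a
  generalize sSup {t : ℝ | AffineMap.lineMap (Ω.coord x) (Ω.coord y) t ∈ Ω.cone} = b
  intro hchord
  have ha := hchord.neg
  have hb := hchord.one_lt
  have hab : a < b := by linarith
  have h0 : (0 : ℝ) ∈ Ioo a b := ⟨ha, by linarith⟩
  have h1 : (1 : ℝ) ∈ Ioo a b := ⟨by linarith, hb⟩
  have hD : Ω.hilbertDist x y = chordLength a b 1 - chordLength a b 0 := by
    have h := hchord.coneDist_eq_of_lt isSharpCone ha one_pos hb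
    rwa [AffineMap.lineMap_apply_zero, AffineMap.lineMap_apply_one, ← hilbertDist_eq] at h
  -- Arclength parametrisation of the chord, shifted so that x is at time 0.
  let T : ℝ → ℝ := fun r => chordPoint a b (r + chordLength a b 0)
  have hT : ∀ r, T r ∈ Ioo a b := fun r => chordPoint_mem hab _
  let γ : ℝ → Ω.carrier := fun r =>
    point (AffineMap.lineMap (Ω.coord x) (Ω.coord y) (T r)) ((hchord.mem_iff _).2 (hT r))
  have hγ : ∀ r, Ω.coord (γ r) = AffineMap.lineMap (Ω.coord x) (Ω.coord y) (T r) := by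
    intro r
    rw [coord_point, AffineMap.lineMap_apply_module, map_add, map_smul, map_smul, chart_coord,
      chart_coord, ← add_smul, sub_add_cancel, one_smul, inv_one, one_smul]
  have hT0 : T 0 = 0 := by
    simp only [T, zero_add]
    exact chordPoint_chordLength h0
  have hTD : T (Ω.hilbertDist x y) = 1 := by
    simp only [T, hD, sub_add_cancel]
    exact chordPoint_chordLength h1
  refine ⟨γ, ?_, ?_, ?_, ?_⟩
  · apply coord_injective
    rw [hγ, hT0, AffineMap.lineMap_apply_zero]
  · apply coord_injective
    rw [hγ, hTD, AffineMap.lineMap_apply_one]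
  · intro s _ t _
    rw [hilbertDist_eq, hγ, hγ, hchord.coneDist_eq isSharpCone (hT s) (hT t),
      chordLength_chordPoint hab, chordLength_chordPoint hab, add_sub_add_right_eq_sub]
  · have hmono : StrictMono T := fun r s hrs => chordPoint_strictMono hab (by linarith)
    ext w
    rw [straight, mem_ofPred_eq, segment_eq_image_lineMap]
    constructor
    · rintro ⟨t, ht, hw⟩
      have ht' : t ∈ Ioo a b := ⟨ha.trans_le ht.1, ht.2.trans_lt hb⟩
      refine ⟨chordLength a b t - chordLength a b 0,
        ⟨sub_nonneg.2 (chordLength_le h0 ht' ht.1), ?_⟩, ?_⟩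
      · rw [hD]
        exact sub_le_sub_right (chordLength_le ht' h1 ht.2) _
      · apply coord_injective
        rw [hγ, ← hw]
        simp only [T, sub_add_cancel]
        rw [chordPoint_chordLength ht']
    · rintro ⟨r, hr, rfl⟩
      refine ⟨T r, ⟨?_, ?_⟩, (hγ r).symm⟩
      · rw [← hT0]
        exact hmono.monotone hr.1
      · rw [← hTD]
        exact hmono.monotone hr.2

/-- The geodesics of a strictly convex body are the straight segments. -/
theorem eq_straight (hstrict : IsStrictCone Ω.cone) {x y : Ω.carrier} {A : Set Ω.carrier}
    (hA : IsGeodesic Ω.hilbertDist x y A) : A = straight x y := by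
  obtain ⟨γ, h0, h1, hγ, rfl⟩ := hA
  have hsub : ∀ r ∈ Icc 0 (Ω.hilbertDist x y), γ r ∈ straight x y := by
    intro r hr
    have hD0 := hr.1.trans hr.2
    have h2 := hγ 0 ⟨le_rfl, hD0⟩ r hr
    have h3 := hγ r hr _ ⟨hD0, le_rfl⟩
    rw [h0, zero_sub, abs_neg, abs_of_nonneg hr.1] at h2
    rw [h1, abs_sub_comm, abs_of_nonneg (sub_nonneg.2 hr.2)] at h3
    refine isSharpCone.mem_segment_of_coneDist_eq hstrict (coord_mem x) (coord_mem _)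
      (coord_mem y) (chart_coord _) (chart_coord _) (chart_coord _) ?_
    rw [← hilbertDist_eq, ← hilbertDist_eq, ← hilbertDist_eq, h2, h3]
    ring
  refine Subset.antisymm ?_ fun w hw => ?_
  · rintro _ ⟨r, hr, rfl⟩
    exact hsub r hr
  -- The point of γ at time r lies on the straight geodesic; its distance to x shows that it is
  -- there at time r too.
  · obtain ⟨γ', h0', -, hγ', himg⟩ := isGeodesic_straight x y
    rw [himg] at hw
    obtain ⟨r, hr, rfl⟩ := hw
    have h2 := hsub r hr
    rw [himg] at h2
    obtain ⟨s, hs, hs'⟩ := h2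
    have hz : (0 : ℝ) ∈ Icc 0 (Ω.hilbertDist x y) := ⟨le_rfl, hr.1.trans hr.2⟩
    have h3 := hγ 0 hz r hr
    have h4 := hγ' 0 hz s hs
    rw [h0, zero_sub, abs_neg, abs_of_nonneg hr.1] at h3
    rw [h0', zero_sub, abs_neg, abs_of_nonneg hs.1, hs', h3] at h4
    exact ⟨r, hr, by rw [← hs', h4]⟩

theorem isThin_of_hyperbolic {δ : ℝ} (h : Ω ∈ hyperbolicBodies d δ) : IsThin Ω.cone δ := by
  intro x hx y hy z hz
  have hC := isSharpCone (Ω := Ω)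
  have hxy := hC.add_mem hx hy
  have hx0 := hC.pos hx
  have hy0 := hC.pos hy
  have hz0 := hC.pos hz
  have hxy0 := hC.pos hxy
  have hu : point (x + y) hxy ∈ straight (point x hx) (point y hy) := by
    rw [straight, mem_ofPred_eq, coord_point, coord_point, coord_point]
    refine ⟨Ω.chart x / Ω.chart (x + y), Ω.chart y / Ω.chart (x + y), by positivity,
      by positivity, ?_, ?_⟩
    · rw [← add_div, ← map_add, div_self hxy0.ne']
    · rw [div_eq_mul_inv, mul_smul, div_eq_mul_inv, mul_smul, smul_comm (Ω.chart x),
        smul_comm (Ω.chart y), smul_inv_smul₀ hx0.ne', smul_inv_smul₀ hy0.ne', smul_add]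
  obtain ⟨v, hv, hclose⟩ := h _ _ (point z hz) _ _ _ (isGeodesic_straight _ _)
    (isGeodesic_straight _ _) (isGeodesic_straight _ _) _ hu
  rw [hilbertDist_le_iff, coord_point] at hclose
  have hfin : ∃ c : ℝ, 0 < c ∧ c • Ω.coord v ∈ segment ℝ y z ∪ segment ℝ z x := by
    rcases hv with hv | hv
    · rw [straight, mem_ofPred_eq, coord_point, coord_point] at hv
      obtain ⟨c, hc, hc'⟩ := exists_smul_mem_segment (inv_pos.2 hy0) (inv_pos.2 hz0) hv
      exact ⟨c, hc, Or.inl hc'⟩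
    · rw [straight, mem_ofPred_eq, coord_point, coord_point] at hv
      obtain ⟨c, hc, hc'⟩ := exists_smul_mem_segment (inv_pos.2 hz0) (inv_pos.2 hx0) hv
      exact ⟨c, hc, Or.inr hc'⟩
  obtain ⟨c, hc, hc'⟩ := hfin
  refine ⟨_, hc', ?_⟩
  have := hC.coneClose_smul hxy0 hc hclose
  rwa [smul_inv_smul₀ hxy0.ne'] at this

/-- All sides are straight by `eq_straight`. An inner point of the first side is a sum of rescaled
vertices; its end points, which `IsThin` does not cover, are on the other sides, and there 0 ≤ δ is
used. -/
theorem hyperbolic_of_isThin {δ : ℝ} (hδ : 0 ≤ δ) (hstrict : IsStrictCone Ω.cone)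
    (h : IsThin Ω.cone δ) : Ω ∈ hyperbolicBodies d δ := by
  intro x y z A B C hA hB hC u hu
  have hcone := isSharpCone (Ω := Ω)
  rw [eq_straight hstrict hA] at hu
  rw [eq_straight hstrict hB, eq_straight hstrict hC]
  obtain ⟨s, t, hs, ht, hst, hu⟩ := hu
  rcases hs.eq_or_lt with rfl | hs
  · refine ⟨y, Or.inl (left_mem_segment ℝ _ _), ?_⟩
    rw [zero_add] at hst
    rw [hst, zero_smul, zero_add, one_smul] at hu
    rw [hilbertDist_le_iff, hu]
    exact hcone.coneClose_refl hδ _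
  rcases ht.eq_or_lt with rfl | ht
  · refine ⟨x, Or.inr (right_mem_segment ℝ _ _), ?_⟩
    rw [add_zero] at hst
    rw [hst, zero_smul, add_zero, one_smul] at hu
    rw [hilbertDist_le_iff, hu]
    exact hcone.coneClose_refl hδ _
  obtain ⟨v, hv, hclose⟩ := h _ (hcone.smul_mem _ (coord_mem x) s hs) _
    (hcone.smul_mem _ (coord_mem y) t ht) _ (coord_mem z)
  have hfin : ∃ c : ℝ, 0 < c ∧ c • v ∈
      segment ℝ (Ω.coord y) (Ω.coord z) ∪ segment ℝ (Ω.coord z) (Ω.coord x) := by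
    rcases hv with hv | hv
    · rw [← one_smul ℝ (Ω.coord z)] at hv
      obtain ⟨c, hc, hc'⟩ := exists_smul_mem_segment ht one_pos hv
      exact ⟨c, hc, Or.inl hc'⟩
    · rw [← one_smul ℝ (Ω.coord z)] at hv
      obtain ⟨c, hc, hc'⟩ := exists_smul_mem_segment one_pos hs hv
      exact ⟨c, hc, Or.inr hc'⟩
  obtain ⟨c, hc, hc'⟩ := hfin
  have key : ∀ a b : Ω.carrier, c • v ∈ segment ℝ (Ω.coord a) (Ω.coord b) →
      ∃ w : Ω.carrier, Ω.coord w = c • v := by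
    intro a b hab
    have hmem := hcone.convex.segment_subset (coord_mem a) (coord_mem b) hab
    obtain ⟨p, q, hp, hq, hpq, hab⟩ := hab
    refine ⟨point (c • v) hmem, ?_⟩
    rw [coord_point, ← hab, map_add, map_smul, map_smul, chart_coord, chart_coord, smul_eq_mul,
      smul_eq_mul, mul_one, mul_one, hpq, inv_one, one_smul]
  have hw : ∃ w : Ω.carrier, Ω.coord w = c • v := by
    rcases hc' with hc' | hc'
    · exact key _ _ hc'
    · exact key _ _ hc'
  obtain ⟨w, hw⟩ := hw
  refine ⟨w, ?_, ?_⟩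
  · rw [← hw] at hc'
    exact hc'
  · rw [hilbertDist_le_iff, hw, ← hu]
    have := hcone.coneClose_smul one_pos hc hclose
    rwa [one_smul] at this

end ConvexBody

/-! ### Closedness of the set of hyperbolic bodies -/

section Main

open Matrix

variable {d : ℕ} {φ : Module.Dual ℝ (Vec d)} {S : Set (ProjSpace d)}

theorem dotProduct_self_le (v : Vec d) : v ⬝ᵥ v ≤ (d + 1) * ‖v‖ ^ 2 := by
  have h : ∀ i ∈ Finset.univ, v i * v i ≤ ‖v‖ ^ 2 := fun i _ => by
    rw [← sq, ← sq_abs]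
    exact pow_le_pow_left₀ (abs_nonneg _) (norm_le_pi_norm v i) 2
  refine (Finset.sum_le_sum h).trans (le_of_eq ?_)
  simp

/-- The set of lines on which `φ ^ 2` is at least `c` times the square of the norm. -/
def chartCore (φ : Module.Dual ℝ (Vec d)) (c : ℝ) : Set (ProjSpace d) :=
  {x | c ≤ φ (Matrix.of (lineMatrix x) *ᵥ dualVec φ)}

theorem isClosed_chartCore (c : ℝ) : IsClosed (chartCore φ c) :=
  isClosed_le continuous_const ((continuous_dual φ).comp continuous_lineMatrix_mulVec)

theorem chartCore_subset {c : ℝ} (hc : 0 < c) : chartCore φ c ⊆ affineChart φ := fun x hx =>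
  (mem_affineChart_iff x).2 (hc.trans_le hx).ne'

/-- Keeps S in a closed part of the chart depending only on the sharpness constant. The factor d + 1
compares the Euclidean norm with the sup norm. -/
theorem subset_chartCore (hS : S ⊆ affineChart φ) {c : ℝ} (hc : 0 < c)
    (hb : ∀ v ∈ coneOver φ S, c * ‖v‖ ≤ φ v) : S ⊆ chartCore φ (c ^ 2 / (d + 1)) := by
  intro x hx
  have hv := (affineCoord_mem_coneOver_iff (hS hx)).2 hx
  have h1 := hb _ hv
  have hφ := apply_affineCoord (hS hx)
  have hv0 := affineCoord_ne_zero (hS hx)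
  rw [← mk_affineCoord (hS hx), chartCore, mem_ofPred_eq, lineMatrix_mk, projMatrix_mulVec,
    map_smul, smul_eq_mul, hφ, mul_one]
  rw [hφ] at h1
  have h2 := dotProduct_self_le (affineCoord φ x)
  have h3 : 0 < affineCoord φ x ⬝ᵥ affineCoord φ x :=
    lt_of_le_of_ne (Finset.sum_nonneg fun i _ => mul_self_nonneg _)
      fun h => hv0 (dotProduct_self_eq_zero.1 h.symm)
  have h4 : (c * ‖affineCoord φ x‖) ^ 2 ≤ 1 := pow_le_one₀ (by positivity) h1
  rw [div_le_div_iff₀ (by positivity) h3]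
  nlinarith [mul_le_mul_of_nonneg_left h2 (sq_nonneg c)]

theorem ConvexBody.closure_subset_chart (Ω : ConvexBody d) :
    _root_.closure Ω.carrier ⊆ affineChart Ω.chart := by
  obtain ⟨c, hc, hb⟩ := Ω.isSharpCone_chart.bound
  exact (closure_minimal (subset_chartCore Ω.subset_chart hc hb) (isClosed_chartCore _)).trans
    (chartCore_subset (by positivity))

theorem isClosed_hyperbolicBodies {δ : ℝ} (hδ : 0 < δ) : IsClosed (hyperbolicBodies d δ) := by
  rw [isClosed_iff_ultrafilter]
  intro Ω 𝒰 hle hmem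
  have hlim : Tendsto (fun i : ConvexBody d => i.closure) 𝒰 (𝓝 Ω.closure) :=
    (continuous_induced_dom.tendsto Ω).mono_left hle
  set φ := Ω.chart with hφ
  have hsub : ∀ᶠ i : ConvexBody d in 𝒰, i.carrier ⊆ affineChart φ := by
    have h1 : ∀ᶠ i : ConvexBody d in 𝒰, (i.closure : Set (ProjSpace d)) ⊆ affineChart φ :=
      hlim ((NonemptyCompacts.isOpen_subsets_of_isOpen isOpen_affineChart).mem_nhds
        Ω.closure_subset_chart)
    exact h1.mono fun i hi => subset_closure.trans hi
  have hcone := isConeLimit_coneOver (Ω := fun i => i) hlim Ω.closure_subset_chart hsub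
  change IsConeLimit 𝒰 _ (insert 0 (coneOver φ (closure Ω.carrier))) at hcone
  rw [← Ω.isSharpCone_chart.closure_coneOver Ω.subset_chart] at hcone
  have hprop : ∀ᶠ i : ConvexBody d in 𝒰, IsOpenCone (coneOver φ i.carrier) ∧
      IsThin (coneOver φ i.carrier) δ := by
    filter_upwards [hsub, hmem] with i hi hi'
    have h1 := ConvexBody.isThin_of_hyperbolic hi'
    have h2 := i.isSharpCone_chart.toIsOpenCone
    -- The distinguished chart of i need not be that of Ω, so thinness is carried over up to sign.
    rcases coneOver_eq_or_neg h2 i.subset_chart hi with h | h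
    · rw [h]
      exact ⟨h2, h1⟩
    · rw [h]
      exact ⟨h2.neg, h1.neg⟩
  have hthin : IsThin Ω.cone δ := hcone.isThin (hprop.mono fun i hi => hi.1) Ω.isSharpCone_chart
    (Eventually.of_forall fun i v hv => hv.1.le) (hprop.mono fun i hi => hi.2)
  exact ConvexBody.hyperbolic_of_isThin hδ.le (Ω.isSharpCone_chart.isStrictCone hthin) hthin

/-! ### Uniform hyperbolicity of closed invariant families -/

/-- The sum of the coordinates. -/
def sumForm (d : ℕ) : Module.Dual ℝ (Vec d) := ∑ i, LinearMap.proj i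

theorem sumForm_apply (v : Vec d) : sumForm d v = ∑ i, v i := by
  simp [sumForm]

/-- All cones inside the orthant are thus sharp for one functional with the same constant 1. -/
theorem norm_le_sumForm {v : Vec d} (hv : ∀ i, 0 ≤ v i) : ‖v‖ ≤ sumForm d v := by
  rw [sumForm_apply]
  refine (pi_norm_le_iff_of_nonneg (Finset.sum_nonneg fun i _ => hv i)).2 fun i => ?_
  rw [Real.norm_of_nonneg (hv i)]
  exact Finset.single_le_sum (fun j _ => hv j) (Finset.mem_univ i)

theorem coneOver_pgl_smul (Ω : ConvexBody d) (A : GL (Fin (d + 1)) ℝ)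
    (hA : ∀ v ∈ Ω.cone, ∀ i, 0 ≤ (A • v) i) :
    (Matrix.ProjGenLinGroup.mk A • Ω).carrier ⊆ affineChart (sumForm d) ∧
    coneOver (sumForm d) (Matrix.ProjGenLinGroup.mk A • Ω).carrier = {w | A⁻¹ • w ∈ Ω.cone} := by
  have hpos : ∀ v ∈ Ω.cone, 0 < sumForm d (A • v) := by
    intro v hv
    have h0 : A • v ≠ 0 := (smul_ne_zero_iff_ne A).2 hv.2.1
    exact (norm_pos_iff.2 h0).trans_le (norm_le_sumForm (hA v hv))
  have hrep : ∀ x ∈ (Matrix.ProjGenLinGroup.mk A • Ω).carrier, ∃ v, ∃ _ : v ∈ Ω.cone,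
      ∃ h : A • v ≠ 0, x = Projectivization.mk ℝ (A • v) h := by
    rintro _ ⟨x, hx, rfl⟩
    have hc := Ω.subset_chart hx
    refine ⟨affineCoord Ω.chart x, (affineCoord_mem_coneOver_iff hc).2 hx,
      (smul_ne_zero_iff_ne A).2 (affineCoord_ne_zero hc), ?_⟩
    conv_lhs => rw [← mk_affineCoord hc]
    rfl
  refine ⟨fun x hx => ?_, Set.ext fun w => ⟨?_, fun hw => ?_⟩⟩
  · obtain ⟨v, hv, h, rfl⟩ := hrep x hx
    exact (mk_mem_affineChart _ _ h).2 (hpos v hv).ne'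
  · rintro ⟨h1, h2, h3⟩
    obtain ⟨v, hv, h, h4⟩ := hrep _ h3
    obtain ⟨a, rfl⟩ := (Projectivization.mk_eq_mk_iff' ℝ _ _ _ _).1 h4
    rw [map_smul, smul_eq_mul] at h1
    have ha : 0 < a := pos_of_mul_pos_left h1 (hpos v hv).le
    rw [mem_ofPred_eq, smul_comm, inv_smul_smul]
    exact smul_mem_coneOver hv ha
  · have hw' : A⁻¹ • w ∈ Ω.cone := hw
    have h1 := hpos _ hw'
    rw [smul_inv_smul] at h1
    refine ⟨h1, ne_zero_of_apply_ne h1.ne', Projectivization.mk ℝ _ hw'.2.1, hw'.2.2, ?_⟩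
    change Projectivization.mk ℝ (A • A⁻¹ • w) _ = _
    congr 1
    exact smul_inv_smul A w

/-- A thick triangle in the cone `C`, normalised by Benzécri's theorem. -/
structure IsThickTriangle (C : Set (Vec d)) (δ : ℝ) (x y z : Vec d) : Prop where
  isOpenCone : IsOpenCone C
  nonneg : ∀ v ∈ C, ∀ i, 0 ≤ v i
  ball : ∀ v : Vec d, ∑ i, |v i - 1| < 1 → v ∈ C
  left_mem : x ∈ C
  right_mem : y ∈ C
  top_mem : z ∈ C
  add_eq : x + y = 1
  sum_top : sumForm d z = 1
  not_close : ∀ a b : ℝ, 0 ≤ a → 0 ≤ b → 0 < a + b →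
    ¬ ConeClose C δ 1 (a • y + b • z) ∧ ¬ ConeClose C δ 1 (a • x + b • z)

theorem exists_isThickTriangle {δ : ℝ} (Ω : ConvexBody d) (h : ¬ IsThin Ω.cone δ) :
    ∃ (g : ProjGroup d) (x y z : Vec d), (g • Ω).carrier ⊆ affineChart (sumForm d) ∧
      IsThickTriangle (coneOver (sumForm d) (g • Ω).carrier) δ x y z := by
  rw [IsThin] at h
  push Not at h
  obtain ⟨x, hx, y, hy, z, hz, hfar⟩ := h
  have hcone := ConvexBody.isSharpCone (Ω := Ω)
  obtain ⟨A, hA1, hA2, hA3⟩ := hcone.exists_normalization (hcone.add_mem hx hy)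
  obtain ⟨hsub, heq⟩ := coneOver_pgl_smul Ω A hA2
  have hz0 : 0 < sumForm d (A • z) :=
    (norm_pos_iff.2 ((smul_ne_zero_iff_ne A).2 hz.2.1)).trans_le (norm_le_sumForm (hA2 z hz))
  -- Unlike x and y, the vertex z has no prescribed scale; sum 1 keeps its limit nonzero.
  set m := (sumForm d (A • z))⁻¹ with hm
  have hm0 : 0 < m := inv_pos.2 hz0
  have hcont : ∀ B : GL (Fin (d + 1)) ℝ, Continuous fun v : Vec d => B • v := fun B =>
    LinearMap.continuous_of_finiteDimensional (DistribSMul.toLinearMap ℝ (Vec d) B)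
  set C := coneOver (sumForm d) (Matrix.ProjGenLinGroup.mk A • Ω).carrier with hC
  have hmem : ∀ v ∈ Ω.cone, A • v ∈ C := by
    intro v hv
    rw [heq, mem_ofPred_eq, inv_smul_smul]
    exact hv
  have hback : ∀ u v : Vec d, ConeClose C δ (A • u) (A • v) → ConeClose Ω.cone δ u v := by
    have hcl : ∀ w ∈ closure C, A⁻¹ • w ∈ closure Ω.cone := fun w hw =>
      map_mem_closure (hcont A⁻¹) hw fun v hv => by rwa [heq] at hv
    rintro u v ⟨a, b, ha, hb, h1, h2, h3⟩
    refine ⟨a, b, ha, hb, ?_, ?_, h3⟩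
    · have := hcl _ h1
      rwa [← smul_comm A a v, ← smul_sub, inv_smul_smul] at this
    · have := hcl _ h2
      rwa [← smul_comm A b u, ← smul_sub, inv_smul_smul] at this
  have hfar' : ∀ p : Vec d, (∀ v ∈ segment ℝ p z, ¬ ConeClose Ω.cone δ (x + y) v) →
      ∀ a b : ℝ, 0 ≤ a → 0 ≤ b → 0 < a + b →
      ¬ ConeClose C δ 1 (a • (A • p) + b • (m • A • z)) := by
    intro p hp a b ha hb hab hclose
    rw [← hA1, smul_smul b m, ← smul_comm A a p, ← smul_comm A (b * m) z, ← smul_add] at hclose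
    have h1 := hback _ _ hclose
    have hbm : 0 ≤ b * m := by positivity
    have hpos : 0 < a + b * m := by
      rcases ha.eq_or_lt with rfl | ha
      · rw [zero_add] at hab ⊢
        positivity
      · positivity
    have h2 := hcone.coneClose_smul one_pos (inv_pos.2 hpos) h1
    rw [one_smul] at h2
    refine hp _ ⟨a / (a + b * m), b * m / (a + b * m), by positivity, by positivity, ?_, ?_⟩ h2
    · rw [← add_div, div_self hpos.ne']
    · rw [smul_add, smul_smul, smul_smul, div_eq_inv_mul, div_eq_inv_mul]
  refine ⟨Matrix.ProjGenLinGroup.mk A, A • x, A • y, m • A • z, hsub, ?_⟩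
  refine ⟨⟨isOpen_coneOver (ConvexBody.isOpen _), ?_, fun v hv t ht => smul_mem_coneOver hv ht⟩,
    ?_, ?_, hmem x hx, hmem y hy, smul_mem_coneOver (hmem z hz) hm0, ?_, ?_, ?_⟩
  · rw [← hC, heq]
    exact hcone.convex.linear_preimage (DistribSMul.toLinearMap ℝ (Vec d) A⁻¹)
  · intro v hv i
    rw [← hC, heq] at hv
    have := hA2 _ hv i
    rwa [smul_inv_smul] at this
  · intro v hv
    rw [← hC, heq]
    refine hA3 _ ?_
    rwa [smul_inv_smul]
  · rw [← smul_add, hA1]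
  · rw [map_smul, smul_eq_mul, hm, inv_mul_cancel₀ hz0.ne']
  · intro a b ha hb hab
    refine ⟨hfar' y (fun v hv => hfar v (Or.inl hv)) a b ha hb hab,
      hfar' x (fun v hv => hfar v (Or.inr ?_)) a b ha hb hab⟩
    rwa [segment_symm]

/-- The limit of a convergent family of normalised convex bodies. -/
theorem exists_limit_body {ι : Type*} {𝒰 : Ultrafilter ι} {Ω : ι → ConvexBody d}
    (hsub : ∀ i, (Ω i).carrier ⊆ affineChart (sumForm d))
    (hcone : ∀ i, IsOpenCone (coneOver (sumForm d) (Ω i).carrier))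
    (hnonneg : ∀ i, ∀ v ∈ coneOver (sumForm d) (Ω i).carrier, ∀ j, 0 ≤ v j)
    (hball : ∀ i, ∀ v : Vec d, ∑ j, |v j - 1| < 1 → v ∈ coneOver (sumForm d) (Ω i).carrier) :
    ∃ Ω₀ : ConvexBody d, Tendsto Ω 𝒰 (𝓝 Ω₀) ∧ Ω₀.carrier ⊆ affineChart (sumForm d) ∧
      IsSharpCone (sumForm d) (coneOver (sumForm d) Ω₀.carrier) ∧
      1 ∈ coneOver (sumForm d) Ω₀.carrier ∧
      IsConeLimit 𝒰 (fun i => coneOver (sumForm d) (Ω i).carrier)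
        (closure (coneOver (sumForm d) Ω₀.carrier)) := by
  set φ := sumForm d with hφ
  obtain ⟨K, -, hlim⟩ := exists_tendsto_of_eventually_mem (𝒰 := 𝒰) isCompact_univ
    (f := fun i => (Ω i).closure) (Eventually.of_forall fun _ => mem_univ _)
  -- The uniform sharpness constant 1 prevents the closures from reaching the hyperplane φ = 0 in
  -- the limit.
  have hK : (K : Set (ProjSpace d)) ⊆ affineChart φ := by
    refine Subset.trans ?_ (chartCore_subset (c := 1 ^ 2 / (d + 1)) (by positivity))
    intro x hx
    obtain ⟨y, hy, hy'⟩ := exists_tendsto_of_mem hlim hx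
    refine (isClosed_chartCore _).mem_of_tendsto hy' (Eventually.of_forall fun i => ?_)
    refine closure_minimal (subset_chartCore (hsub i) one_pos fun v hv => ?_)
      (isClosed_chartCore _) (hy i)
    rw [one_mul]
    exact norm_le_sumForm (hnonneg i v hv)
  have hL := isConeLimit_coneOver hlim hK (Eventually.of_forall hsub)
  set T : Set (Vec d) := insert 0 (coneOver φ K) with hT
  have hTnn : ∀ v ∈ T, ∀ j, 0 ≤ v j := by
    intro v hv j
    obtain ⟨w, hw, hw'⟩ := hL.exists_lim v hv
    refine ge_of_tendsto (((continuous_apply j).tendsto v).comp hw') (hw.mono fun i hi => ?_)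
    exact closure_minimal (t := {v : Vec d | 0 ≤ v j}) (fun v hv => hnonneg i v hv j)
      (isClosed_le continuous_const (continuous_apply j)) hi
  have hTadd : ∀ u ∈ T, ∀ v ∈ T, u + v ∈ T := by
    intro u hu v hv
    obtain ⟨a, ha, ha'⟩ := hL.exists_lim u hu
    obtain ⟨b, hb, hb'⟩ := hL.exists_lim v hv
    refine hL.mem_of_lim _ _ ?_ (ha'.add hb')
    filter_upwards [ha, hb] with i hi hi'
    exact (hcone i).add_mem_closure hi hi'
  have hTsmul : ∀ v ∈ T, ∀ t : ℝ, 0 ≤ t → t • v ∈ T := by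
    intro v hv t ht
    obtain ⟨a, ha, ha'⟩ := hL.exists_lim v hv
    refine hL.mem_of_lim _ _ ?_ (ha'.const_smul t)
    filter_upwards [ha] with i hi
    exact (hcone i).smul_mem_closure' hi ht
  have hTconv : Convex ℝ T := fun u hu v hv a b ha hb _ =>
    hTadd _ (hTsmul u hu a ha) _ (hTsmul v hv b hb)
  have hTclosed : IsClosed T := by
    refine isClosed_of_closure_subset fun v hv => ?_
    by_cases h0 : v = 0
    · exact Or.inl h0
    have hvnn : ∀ j, 0 ≤ v j := fun j =>
      closure_minimal (t := {v : Vec d | 0 ≤ v j}) (fun v hv => hTnn v hv j)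
        (isClosed_le continuous_const (continuous_apply j)) hv
    have hφv : 0 < φ v := (norm_pos_iff.2 h0).trans_le (norm_le_sumForm hvnn)
    have hcl : v ∈ closure (coneOver φ K) := by
      rw [hT, insert_eq, closure_union, closure_singleton] at hv
      exact hv.resolve_left h0
    rw [mem_closure_coneOver_iff hK hφv, K.isCompact.isClosed.closure_eq] at hcl
    exact Or.inr ⟨hφv, h0, hcl⟩
  -- The neighbourhood common to all the cones survives in T: the limit does not degenerate.
  have hone : (1 : Vec d) ∈ interior T := by
    refine mem_interior.2 ⟨{v | ∑ j, |v j - 1| < 1}, fun v hv => ?_, ?_, ?_⟩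
    · exact hL.mem_of_lim (fun _ => v) v
        (Eventually.of_forall fun i => subset_closure (hball i v hv)) tendsto_const_nhds
    · refine isOpen_lt ?_ continuous_const
      exact continuous_finsetSum _ fun j _ =>
        ((continuous_apply j).sub continuous_const).abs
    · simp
  have hclT : closure (interior T) = T := by
    rw [hTconv.closure_interior_eq_closure_of_nonempty_interior ⟨1, hone⟩, hTclosed.closure_eq]
  have hsharp : IsSharpCone φ (interior T) := by
    refine ⟨⟨isOpen_interior, hTconv.interior, fun v hv t ht => ?_⟩, ⟨1, hone⟩, fun h0 => ?_,
      1, one_pos, fun v hv => ?_⟩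
    · rw [mem_interior_iff_mem_nhds] at hv ⊢
      have h1 : Tendsto (fun w : Vec d => t⁻¹ • w) (𝓝 (t • v)) (𝓝 v) := by
        have : Continuous fun w : Vec d => t⁻¹ • w := continuous_const_smul _
        have h2 := this.tendsto (t • v)
        rwa [inv_smul_smul₀ ht.ne'] at h2
      filter_upwards [h1 hv] with w hw
      have := hTsmul _ hw t ht.le
      rwa [smul_inv_smul₀ ht.ne'] at this
    -- If 0 were interior, T would contain small negative multiples of 1, although it lies in the
    -- orthant.
    · rw [mem_interior_iff_mem_nhds] at h0
      have h1 : Tendsto (fun t : ℝ => t • (-1 : Vec d)) (𝓝[>] 0) (𝓝 0) := by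
        have : Continuous fun t : ℝ => t • (-1 : Vec d) := by fun_prop
        simpa using (this.tendsto 0).mono_left nhdsWithin_le_nhds
      have h2 : ∀ᶠ t : ℝ in 𝓝[>] 0, t • (-1 : Vec d) ∈ T := h1 h0
      obtain ⟨t, ht, ht0⟩ := (h2.and (self_mem_nhdsWithin (s := Ioi (0 : ℝ)))).exists
      have h3 := hTnn _ ht 0
      have h4 : (0 : ℝ) < t := ht0
      simp only [Pi.smul_apply, Pi.neg_apply, Pi.one_apply, smul_eq_mul] at h3
      linarith
    · rw [one_mul]
      exact norm_le_sumForm (hTnn v (interior_subset hv))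
  obtain ⟨Ω₀, hΩ₀, hΩ₀C⟩ := hsharp.exists_convexBody
  refine ⟨Ω₀, ?_, hΩ₀, hΩ₀C.symm ▸ hsharp, hΩ₀C.symm ▸ hone, ?_⟩
  · have hKeq : K = Ω₀.closure := by
      apply SetLike.coe_injective
      change (K : Set (ProjSpace d)) = closure Ω₀.carrier
      refine Subset.antisymm (fun x hx => ?_) (closure_minimal (fun x hx => ?_)
        K.isCompact.isClosed)
      · have hc := hK hx
        have h1 : affineCoord φ x ∈ closure (coneOver φ Ω₀.carrier) := by
          rw [hΩ₀C, hclT]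
          exact Or.inr ((affineCoord_mem_coneOver_iff hc).2 hx)
        rw [mem_closure_coneOver_iff hΩ₀ (by rw [apply_affineCoord hc]; exact one_pos)] at h1
        rwa [mk_affineCoord hc] at h1
      · have hc := hΩ₀ hx
        have h1 := (affineCoord_mem_coneOver_iff hc).2 hx
        rw [hΩ₀C] at h1
        exact (affineCoord_mem_coneOver_iff hc).1
          ((interior_subset h1).resolve_left (affineCoord_ne_zero hc))
    rw [hKeq] at hlim
    have hind : IsInducing (ConvexBody.closure (d := d)) := ⟨rfl⟩
    exact hind.tendsto_nhds_iff.2 hlim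
  · rw [hΩ₀C, hclT]
    exact hL

theorem exists_subset_hyperbolicBodies {F : Set (ConvexBody d)} (hF : IsClosed F)
    (hinv : ∀ g : ProjGroup d, ∀ Ω ∈ F, g • Ω ∈ F) (hstrict : ∀ Ω ∈ F, Ω.IsStrictlyConvex) :
    ∃ δ : ℝ, 0 < δ ∧ F ⊆ hyperbolicBodies d δ := by
  by_contra! hcon
  set φ := sumForm d with hφ
  have hseq : ∀ n : ℕ, ∃ (Ω : ConvexBody d) (x y z : Vec d), Ω ∈ F ∧
      Ω.carrier ⊆ affineChart φ ∧ IsThickTriangle (coneOver φ Ω.carrier) (n + 1) x y z := by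
    intro n
    obtain ⟨Ω, hΩ, hΩ'⟩ := not_subset.1 (hcon (n + 1) (by positivity))
    have hthin : ¬ IsThin Ω.cone (n + 1) := fun h => hΩ'
      (ConvexBody.hyperbolic_of_isThin (by positivity)
        (isStrictCone_of_isStrictlyConvex (hstrict Ω hΩ) Ω.isSharpCone_chart Ω.subset_chart) h)
    obtain ⟨g, x, y, z, h1, h2⟩ := exists_isThickTriangle Ω hthin
    exact ⟨g • Ω, x, y, z, hinv g Ω hΩ, h1, h2⟩
  choose Ω x y z hΩF hsub hthick using hseq
  let 𝒰 : Ultrafilter ℕ := hyperfilter ℕ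
  obtain ⟨Ω₀, hlim, hΩ₀sub, hsharp, hone, hL⟩ := exists_limit_body (𝒰 := 𝒰) hsub
    (fun n => (hthick n).isOpenCone) (fun n => (hthick n).nonneg) (fun n => (hthick n).ball)
  have hΩ₀F : Ω₀ ∈ F := hF.mem_of_tendsto hlim (Eventually.of_forall hΩF)
  set C₀ := coneOver φ Ω₀.carrier with hC₀
  have hSC : IsStrictCone C₀ :=
    isStrictCone_of_isStrictlyConvex (hstrict Ω₀ hΩ₀F) hsharp hΩ₀sub
  have hopen : ∀ᶠ n in 𝒰, IsOpenCone (coneOver φ (Ω n).carrier) :=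
    Eventually.of_forall fun n => (hthick n).isOpenCone
  -- limits of the vertices
  have hbox : ∀ w : ℕ → Vec d, (∀ n, w n ∈ coneOver φ (Ω n).carrier) → (∀ n i, w n i ≤ 1) →
      ∃ v ∈ closure C₀, Tendsto w 𝒰 (𝓝 v) := by
    intro w hw hw1
    obtain ⟨v, -, hv⟩ := exists_tendsto_of_eventually_mem (𝒰 := 𝒰)
      (isCompact_Icc (a := (0 : Vec d)) (b := 1)) (f := w)
      (Eventually.of_forall fun n => ⟨(hthick n).nonneg _ (hw n), hw1 n⟩)
    exact ⟨v, hL.mem_of_lim w v (Eventually.of_forall fun n => subset_closure (hw n)) hv, hv⟩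
  have hadd1 : ∀ n i, x n i + y n i = 1 := fun n i => congrFun (hthick n).add_eq i
  obtain ⟨x₀, hx₀, hxlim⟩ := hbox x (fun n => (hthick n).left_mem) fun n i => by
    linarith [hadd1 n i, (hthick n).nonneg _ (hthick n).right_mem i]
  obtain ⟨y₀, hy₀, hylim⟩ := hbox y (fun n => (hthick n).right_mem) fun n i => by
    linarith [hadd1 n i, (hthick n).nonneg _ (hthick n).left_mem i]
  obtain ⟨z₀, hz₀, hzlim⟩ := hbox z (fun n => (hthick n).top_mem) fun n i => by
    have h1 := norm_le_sumForm ((hthick n).nonneg _ (hthick n).top_mem)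
    rw [(hthick n).sum_top] at h1
    exact (le_abs_self _).trans ((norm_le_pi_norm (z n) i).trans h1)
  have hsum : x₀ + y₀ = 1 := by
    refine tendsto_nhds_unique (hxlim.add hylim) ?_
    simp only [(hthick _).add_eq]
    exact tendsto_const_nhds
  have hφz : φ z₀ = 1 := by
    refine tendsto_nhds_unique (((continuous_dual φ).tendsto z₀).comp hzlim) ?_
    simp only [Function.comp_def, hφ, (hthick _).sum_top]
    exact tendsto_const_nhds
  -- points of the cone are at bounded distance from `1`
  have hfar : ∀ (w : ℕ → Vec d) (v : Vec d), Tendsto w 𝒰 (𝓝 v) → v ∈ C₀ →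
      ∃ n : ℕ, ConeClose (coneOver φ (Ω n).carrier) (n + 1) 1 (w n) := by
    intro w v hw hv
    obtain ⟨a, ha, ha0⟩ :=
      ((hsharp.eventually_smul_sub_mem hv 1).and (eventually_gt_atTop 0)).exists
    obtain ⟨b, hb, hb0⟩ :=
      ((hsharp.eventually_smul_sub_mem hone v).and (eventually_gt_atTop 0)).exists
    have h1 := hL.eventually_mem hopen hsharp.toIsOpenCone ha
      ((hw.const_smul a).sub tendsto_const_nhds)
    have h2 := hL.eventually_mem hopen hsharp.toIsOpenCone hb (tendsto_const_nhds.sub hw)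
    -- The constants a, b are fixed while the allowed bound exp (2 (n + 1)) grows beyond n.
    have h3 : ∀ᶠ n : ℕ in 𝒰, a * b ≤ n :=
      Nat.hyperfilter_le_atTop (tendsto_natCast_atTop_atTop.eventually_ge_atTop (a * b))
    obtain ⟨n, hn1, hn2, hn3⟩ := (h1.and (h2.and h3)).exists
    refine ⟨n, a, b, ha0, hb0, subset_closure hn1, subset_closure hn2, ?_⟩
    have h4 := Real.add_one_le_exp (2 * ((n : ℝ) + 1))
    have h5 : (0 : ℝ) ≤ n := n.cast_nonneg
    linarith
  -- The two limit sides miss the open cone: an interior limit point would be at bounded distance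
  -- from 1, against thickness.
  have hbdy : ∀ a b : ℝ, 0 ≤ a → 0 ≤ b → 0 < a + b →
      a • y₀ + b • z₀ ∉ C₀ ∧ a • x₀ + b • z₀ ∉ C₀ := by
    intro a b ha hb hab
    constructor
    · intro hmem
      obtain ⟨n, hn⟩ := hfar _ _ ((hylim.const_smul a).add (hzlim.const_smul b)) hmem
      exact ((hthick n).not_close a b ha hb hab).1 hn
    · intro hmem
      obtain ⟨n, hn⟩ := hfar _ _ ((hxlim.const_smul a).add (hzlim.const_smul b)) hmem
      exact ((hthick n).not_close a b ha hb hab).2 hn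
  have hz₀0 : z₀ ≠ 0 := ne_zero_of_apply_ne (φ := φ) (by rw [hφz]; exact one_ne_zero)
  have hpar : ∀ p ∈ closure C₀, (∀ a b : ℝ, 0 ≤ a → 0 ≤ b → 0 < a + b → a • p + b • z₀ ∉ C₀) →
      ∃ t : ℝ, p = t • z₀ := by
    intro p hp hnot
    have hli : ¬ LinearIndependent ℝ ![z₀, p] := by
      intro hli
      obtain ⟨w, ⟨a, b, ha, hb, hab, rfl⟩, hw⟩ := hSC z₀ hz₀ p hp hli
      rw [add_comm] at hw
      exact hnot b a hb ha (by linarith) hw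
    rw [LinearIndependent.pair_iff' hz₀0] at hli
    push Not at hli
    obtain ⟨t, ht⟩ := hli
    exact ⟨t, ht.symm⟩
  obtain ⟨s, hs⟩ := hpar x₀ hx₀ fun a b ha hb hab => (hbdy a b ha hb hab).2
  obtain ⟨t, ht⟩ := hpar y₀ hy₀ fun a b ha hb hab => (hbdy a b ha hb hab).1
  -- Both sides have collapsed to the ray of z₀, so the interior vector 1 = x₀ + y₀ is a multiple of
  -- z₀, itself not interior by `hbdy`.
  have hst : (s + t) • z₀ = 1 := by rw [add_smul, ← hs, ← ht, hsum]
  have hpos : 0 < s + t := by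
    have h1 := hsharp.pos hone
    rw [← hst, map_smul, hφz, smul_eq_mul, mul_one] at h1
    exact h1
  refine (hbdy 0 1 le_rfl zero_le_one (by norm_num)).1 ?_
  rw [zero_smul, zero_add, one_smul]
  have := hsharp.smul_mem _ hone _ (inv_pos.2 hpos)
  rwa [← hst, inv_smul_smul₀ hpos.ne'] at this

end Main

end HilbertGeometry

end

open HilbertGeometry in
theorem mainTheorem7 (d : ℕ) :
    (∀ δ : ℝ, 0 < δ → IsClosed (hyperbolicBodies d δ)) ∧
    (∀ F : Set (ConvexBody d), IsClosed F →
      (∀ g : ProjGroup d, ∀ Ω ∈ F, g • Ω ∈ F) →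
      (∀ Ω ∈ F, Ω.IsStrictlyConvex) →
      ∃ δ : ℝ, 0 < δ ∧ F ⊆ hyperbolicBodies d δ) := by
  exact ⟨fun δ hδ => isClosed_hyperbolicBodies hδ, fun F hF hinv hstrict =>
    exists_subset_hyperbolicBodies hF hinv hstrict⟩
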